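/- Consider the model problem: minimize $f(\mathcal{A}X)$ over $X\in\mathbb{R}^{m\times n}$ subject to $\|X\|_{S_1}\le\alpha$ (Schatten 1-norm), where $f:\mathbb{R}^d\to\mathbb{R}$ is convex and continuously differentiable, $\alpha\ge 0$, and $\mathcal{A}X=(\langle A_1,X\rangle,\dots,\langle A_d,X\rangle)$ with adjoint $\mathcal{A}^*z=\sum_i z_iA_i$, for given $A_i\in\mathbb{R}^{m\times n}$ (Frobenius inner products). Put $\eta_t=2/(t+2)$. The conditional gradient method (CGM) generates $X_0=0$ and, for $t=0,1,2,\dots$, $$X_{t+1}=(1-\eta_t)X_t+\eta_tH_t,\qquad H_t=-\alpha u_tv_t^*,$$ where $(u_t,v_t)$ is a left/right pair of unit singular vectors belonging to the maximum singular value of $\mathcal{A}^*(\nabla f(\mathcal{A}X_t))$, returned by some routine MaxSingVec. Fix a target rank $r$ and draw independent standard normal matrices $\Omega\in\mathbb{R}^{n\times(2r+1)}$ and $\Psi\in\mathbb{R}^{(4r+3)\times m}$. SketchyCGM, run without stopping and with the same routine MaxSingVec, sets $z_0=0$, $Y_0=0$, $W_0=0$ and, for $t=0,1,2,\dots$, $$z_{t+1}=(1-\eta_t)z_t+\eta_t\mathcal{A}(-\alpha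 u_tv_t^*),\quad Y_{t+1}=(1-\eta_t)Y_t+\eta_t(-\alpha u_tv_t^*)\Omega,\quad W_{t+1}=(1-\eta_t)W_t+\eta_t\Psi(-\alpha u_tv_t^*),$$ where $(u_t,v_t)$ is the output of MaxSingVec on $\mathcal{A}^*(\nabla f(z_t))$. Its rank-$r$ reconstruction at time $t$ is $\hat X_t=Q[B]_r$, where $Q$ is a matrix with orthonormal columns that span the range of $Y_t$, $B=(\Psi Q)^\dagger W_t$, $\dagger$ is the Moore–Penrose pseudoinverse, and $[M]_r$ denotes a best approximation of $M$ of rank at most $r$ in the Frobenius norm $\|\cdot\|_F$. (The choices of $Q$ and $[B]_r$ are arbitrary, subject to $\hat X_t$ being a random matrix, i.e. measurable.) Suppose that the CGM iterates $X_t$ converge to a matrix $X_{\mathrm{cgm}}$. Then $\mathbb{E}\|\hat X_t-X_{\mathrm{cgm}}\|_F$ is finite for each $t$, it has a limit as $t\to\infty$, and $$\lim_{t\to\infty}\mathbb{E}\|\hat X_t-X_{\mathrm{cgm}}\|_F\le 3\sqrt2\,\|X_{\mathrm{cgm}}-[X_{\mathrm{cgm}}]_r\|_F.$$ In particular, if $\operatorname{rank}X_{\mathrm{cgm}}\le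 r$, then $\mathbb{E}\|\hat X_t-X_{\mathrm{cgm}}\|_F\to0$. -/

import Mathlib

open Filter Topology MeasureTheory ProbabilityTheory
-- `‖M‖` denotes the Frobenius norm of a matrix `M`.
open scoped Matrix Matrix.Norms.Frobenius

namespace SketchyCGM

/-! ### Matrix analysis -/

/-- `C` is a best rank-`r` approximation of `M` in the Frobenius norm. -/
def IsBestRankApprox {m n : ℕ} (r : ℕ) (M C : Matrix (Fin m) (Fin n) ℝ) : Prop :=
  C.rank ≤ r ∧ ∀ D : Matrix (Fin m) (Fin n) ℝ, D.rank ≤ r → ‖M - C‖ ≤ ‖M - D‖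

/-- `P` is the (Moore–Penrose) pseudoinverse of `M`. -/
structure IsPseudoinverse {m n : ℕ} (M : Matrix (Fin m) (Fin n) ℝ)
    (P : Matrix (Fin n) (Fin m) ℝ) : Prop where
  mul_mul_self : M * P * M = M
  self_mul_mul : P * M * P = P
  symm_left : (M * P)ᵀ = M * P
  symm_right : (P * M)ᵀ = P * M

/-- `σ` is a singular value of `M` with left / right unit singular vectors `u`, `v`. -/
structure IsSingularTriple {m n : ℕ} (M : Matrix (Fin m) (Fin n) ℝ) (σ : ℝ)
    (u : Fin m → ℝ) (v : Fin n → ℝ) : Prop where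
  nonneg : 0 ≤ σ
  unit_left : u ⬝ᵥ u = 1
  unit_right : v ⬝ᵥ v = 1
  mulVec_right : M *ᵥ v = σ • u
  mulVec_left : Mᵀ *ᵥ u = σ • v

/-- `(u, v)` is a left / right pair of maximum singular vectors of `M`. -/
def IsMaxSingPair {m n : ℕ} (M : Matrix (Fin m) (Fin n) ℝ)
    (u : Fin m → ℝ) (v : Fin n → ℝ) : Prop :=
  ∃ σ : ℝ, IsSingularTriple M σ u v ∧
    ∀ (τ : ℝ) (x : Fin m → ℝ) (y : Fin n → ℝ), IsSingularTriple M τ x y → τ ≤ σ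

/-! ### The model problem `minimize f (𝒜 X)` subject to `‖X‖_{S₁} ≤ α` -/

/-- The linear map `𝒜 X = (⟨A₁, X⟩, …, ⟨A_d, X⟩)`, with Frobenius inner products. -/
noncomputable def measure {m n d : ℕ} (A : Fin d → Matrix (Fin m) (Fin n) ℝ)
    (X : Matrix (Fin m) (Fin n) ℝ) : EuclideanSpace ℝ (Fin d) :=
  WithLp.toLp 2 fun i => ∑ a, ∑ b, A i a b * X a b

/-- The adjoint map `𝒜* z = ∑ᵢ zᵢ Aᵢ`. -/
noncomputable def measureAdjoint {m n d : ℕ} (A : Fin d → Matrix (Fin m) (Fin n) ℝ)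
    (z : EuclideanSpace ℝ (Fin d)) : Matrix (Fin m) (Fin n) ℝ :=
  ∑ i, z i • A i

/-- The learning rate `η_t = 2 / (t + 2)`. -/
noncomputable def stepSize (t : ℕ) : ℝ := 2 / ((t : ℝ) + 2)

/-- The rank-one update direction `-α u vᵀ`, where `(u, v)` is the pair of singular vectors. -/
noncomputable def direction {m n : ℕ} (α : ℝ) (uv : (Fin m → ℝ) × (Fin n → ℝ)) :
    Matrix (Fin m) (Fin n) ℝ :=
  (-α) • Matrix.vecMulVec uv.1 uv.2

/-- The iterates `X_t` of the conditional gradient method. The routine `maxSingVec t` is the one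
called for the singular vectors at iteration `t`. -/
noncomputable def cgm {m n d : ℕ} (A : Fin d → Matrix (Fin m) (Fin n) ℝ)
    (f : EuclideanSpace ℝ (Fin d) → ℝ) (α : ℝ)
    (maxSingVec : ℕ → Matrix (Fin m) (Fin n) ℝ → (Fin m → ℝ) × (Fin n → ℝ)) :
    ℕ → Matrix (Fin m) (Fin n) ℝ
  | 0 => 0
  | t + 1 =>
    let X := cgm A f α maxSingVec t
    let H := direction α (maxSingVec t (measureAdjoint A (gradient f (measure A X))))
    (1 - stepSize t) • X + stepSize t • H

/-! ### SketchyCGM -/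

/-- The variables of SketchyCGM: the dual variable `z` and the sketch `(Y, W)`, where
`Y` has `k = 2 r + 1` columns and `W` has `ℓ = 4 r + 3` rows. -/
structure State (m n d r : ℕ) where
  z : EuclideanSpace ℝ (Fin d)
  Y : Matrix (Fin m) (Fin (2 * r + 1)) ℝ
  W : Matrix (Fin (4 * r + 3)) (Fin n) ℝ

/-- The SketchyCGM iteration (run without stopping) with test matrices `Omega` and `Psi`. -/
noncomputable def sketchyCGM {m n d r : ℕ} (A : Fin d → Matrix (Fin m) (Fin n) ℝ)
    (f : EuclideanSpace ℝ (Fin d) → ℝ) (α : ℝ)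
    (maxSingVec : ℕ → Matrix (Fin m) (Fin n) ℝ → (Fin m → ℝ) × (Fin n → ℝ))
    (Omega : Matrix (Fin n) (Fin (2 * r + 1)) ℝ)
    (Psi : Matrix (Fin (4 * r + 3)) (Fin m) ℝ) : ℕ → State m n d r
  | 0 => ⟨0, 0, 0⟩
  | t + 1 =>
    let S := sketchyCGM A f α maxSingVec Omega Psi t
    let H := direction α (maxSingVec t (measureAdjoint A (gradient f S.z)))
    { z := (1 - stepSize t) • S.z + stepSize t • measure A H
      Y := (1 - stepSize t) • S.Y + stepSize t • (H * Omega)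
      W := (1 - stepSize t) • S.W + stepSize t • (Psi * H) }

/-- `Xhat` is a rank-`r` reconstruction from the sketch `(Y, W)`:
`Q = orth(Y)` has orthonormal columns that span the range of `Y`, `B = (Ψ Q)† W`, and
`Xhat = Q [B]_r`. -/
def IsReconstruction {m n k l : ℕ} (r : ℕ) (Psi : Matrix (Fin l) (Fin m) ℝ)
    (Y : Matrix (Fin m) (Fin k) ℝ) (W : Matrix (Fin l) (Fin n) ℝ)
    (Xhat : Matrix (Fin m) (Fin n) ℝ) : Prop :=
  ∃ (p : ℕ) (Q : Matrix (Fin m) (Fin p) ℝ) (P : Matrix (Fin p) (Fin l) ℝ)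
    (Br : Matrix (Fin p) (Fin n) ℝ),
    Qᵀ * Q = 1 ∧
    Submodule.span ℝ (Set.range Q.col) = Submodule.span ℝ (Set.range Y.col) ∧
    IsPseudoinverse (Psi * Q) P ∧
    IsBestRankApprox r (P * W) Br ∧
    Xhat = Q * Br

/-- The random matrix `G` is standard normal: its entries are independent `N(0, 1)` variables. -/
def IsStandardNormal {Ω : Type*} [MeasurableSpace Ω] {a b : ℕ}
    (G : Ω → Matrix (Fin a) (Fin b) ℝ) (μ : Measure Ω) : Prop :=
  HasLaw (fun ω (ij : Fin a × Fin b) => G ω ij.1 ij.2)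
    (Measure.pi fun _ : Fin a × Fin b => gaussianReal 0 1) μ

/-- The random matrices `G` and `G'` are independent (as families of entries). -/
def IndepMatrices {Ω : Type*} [MeasurableSpace Ω] {a b a' b' : ℕ}
    (G : Ω → Matrix (Fin a) (Fin b) ℝ) (G' : Ω → Matrix (Fin a') (Fin b') ℝ)
    (μ : Measure Ω) : Prop :=
  IndepFun (fun ω (ij : Fin a × Fin b) => G ω ij.1 ij.2)
    (fun ω (ij : Fin a' × Fin b') => G' ω ij.1 ij.2) μ

end SketchyCGM

/-!
The matrices `Y_t` and `W_t` depend linearly on the past directions, so SketchyCGM follows the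
conditional gradient method exactly: `z_t = 𝒜 X_t`, `Y_t = X_t Ω` and `W_t = Ψ X_t`
(`sketchyCGM_eq`). It remains to study, for a convergent deterministic sequence `X_t → X'`, the best
rank-`r` approximations `Xhat_t` of the oblique projections
`M_t = Y_t (Ψ Y_t)† Ψ X_t` of `X_t` onto the column space of `Y_t = X_t Ω`
(`IsReconstruction.isBestRankApprox`), where `Ω` has `k = 2 r + 1` columns and `Ψ` has
`l = 2 k + 1` rows.

**Error bound.** Let `Π` be the orthogonal projection onto the column space of `Y = A Ω`. The
oblique projection is `M = Π A + E` where the error `E = Y (Ψ Y)† Ψ (1 - Π) A` has a mean square of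
at most that of the residual `(1 - Π) A` (`lintegral_norm_sq_obliqueProj_mul_le`): `Ψ (1 - Π)` and
`Ψ Π` are independent, and the pseudoinverse of a Gaussian matrix with `l ≥ 2 k + 1` rows and `k`
columns has a mean square of at most one (`lintegral_norm_sq_leftInv_le`), as the first inverse
moment of a chi-squared variable shows. The same two facts, for `Ω`, yield a competitor of rank at
most `r` in the column space of `Y` whose mean square distance to `A` is at most `2 ‖A - [A]_r‖²`
(`exists_competitor`). The residual is no larger than this distance, and `[M]_r` is at most `2 ‖E‖`
farther from `A` than the competitor, so its expected error is at most `(1 + 2) √2 ‖A - [A]_r‖`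
(`exists_error_bound`).

**Passage to the limit, `rank X' ≥ k`.** Almost surely `Ψ X' Ω` has independent columns, so that
`M_t` tends to the oblique projection `M` of `X'`. Truncation is not continuous, since `M` may have
several best approximations, which need not have the same distance to `X'`. However, this happens
with probability zero (`ae_obliqueProj_mul_notMem_ambiguousSet`): scaling the part `Ψ (1 - Π)` of
the test matrix moves `M` along a line `θ ↦ Π X' + θ E`, and `‖[M]_r - X'‖` can be expressed by the
distance of `M` to the matrices of rank at most `r` and by its derivative along the line, which
exists for almost every `θ` as the distance is Lipschitz (`ae_notMem_ambiguousSet`). So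
`‖Xhat_t - X'‖` converges almost surely to the error of the reconstruction for `X'`, and the
expectations converge as the second moments are bounded (`exists_tendsto_integral_of_le_rank`).

**Passage to the limit, `rank X' ≤ k`.** Now `(Ψ Y_t)†` may be unbounded, but `X' Ω T = X'` for some
`T`, so the residuals of the projections `Π_t` tend to zero in mean square
(`tendsto_lintegral_norm_sq_residual`). Hence so does `M_t - X'`, and the errors tend in mean to
`‖X' - [X']_r‖` (`tendsto_integral_of_rank_le`). If `rank X_t < k`, the reconstruction is a best
approximation of `X_t` itself (`IsReconstruction.isBestRankApprox_self`).
-/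

namespace SketchyCGM

/-! ### Frobenius norm, orthogonality and bases of column spaces -/

section Frobenius

variable {m n p : Type*} [Fintype m] [Fintype n] [Fintype p]

lemma norm_sq_eq_sum (A : Matrix m n ℝ) : ‖A‖ ^ 2 = ∑ i, ∑ j, A i j ^ 2 := by
  rw [Matrix.frobenius_norm_def, ← Real.sqrt_eq_rpow, Real.sq_sqrt (by positivity)]
  simp

lemma norm_sq_eq_trace (A : Matrix m n ℝ) : ‖A‖ ^ 2 = (Aᵀ * A).trace := by
  rw [norm_sq_eq_sum, Matrix.trace, Finset.sum_comm]
  simp [Matrix.mul_apply, sq]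

lemma norm_add_sq_eq (A B : Matrix m n ℝ) :
    ‖A + B‖ ^ 2 = ‖A‖ ^ 2 + 2 * (Aᵀ * B).trace + ‖B‖ ^ 2 := by
  have h : (Bᵀ * A).trace = (Aᵀ * B).trace := by
    rw [← Matrix.trace_transpose, Matrix.transpose_mul, Matrix.transpose_transpose]
  simp only [norm_sq_eq_trace, Matrix.transpose_add, Matrix.add_mul, Matrix.mul_add,
    Matrix.trace_add, h]
  ring

lemma norm_add_sq_of_transpose_mul_eq_zero {A B : Matrix m n ℝ} (h : Aᵀ * B = 0) :
    ‖A + B‖ ^ 2 = ‖A‖ ^ 2 + ‖B‖ ^ 2 := by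
  rw [norm_add_sq_eq, h]; simp

lemma norm_add_sq_of_mul_transpose_eq_zero {A B : Matrix m n ℝ} (h : A * Bᵀ = 0) :
    ‖A + B‖ ^ 2 = ‖A‖ ^ 2 + ‖B‖ ^ 2 := by
  rw [norm_add_sq_eq, Matrix.trace_mul_comm, ← Matrix.trace_transpose, Matrix.transpose_mul,
    Matrix.transpose_transpose, h]
  simp

/-- Multiplication by a matrix with orthonormal columns is isometric. -/
lemma norm_mul_of_transpose_mul_self [DecidableEq p] {Q : Matrix m p ℝ} (hQ : Qᵀ * Q = 1)
    (B : Matrix p n ℝ) : ‖Q * B‖ = ‖B‖ := by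
  rw [← sq_eq_sq₀ (norm_nonneg _) (norm_nonneg _), norm_sq_eq_trace, norm_sq_eq_trace,
    Matrix.transpose_mul, Matrix.mul_assoc, ← Matrix.mul_assoc Qᵀ, hQ, Matrix.one_mul]

lemma norm_mul_transpose_of_transpose_mul_self [DecidableEq p] {V : Matrix n p ℝ}
    (hV : Vᵀ * V = 1) (B : Matrix m p ℝ) : ‖B * Vᵀ‖ = ‖B‖ := by
  rw [← Matrix.frobenius_norm_transpose, Matrix.transpose_mul, Matrix.transpose_transpose,
    norm_mul_of_transpose_mul_self hV, Matrix.frobenius_norm_transpose]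

/-- An orthogonal projection, given as a symmetric idempotent, splits the Frobenius norm. -/
lemma norm_sq_eq_add_of_proj [DecidableEq m] {P : Matrix m m ℝ} (hs : Pᵀ = P) (hi : P * P = P)
    (A : Matrix m n ℝ) : ‖A‖ ^ 2 = ‖P * A‖ ^ 2 + ‖(1 - P) * A‖ ^ 2 := by
  rw [← norm_add_sq_of_transpose_mul_eq_zero, ← Matrix.add_mul, add_sub_cancel, Matrix.one_mul]
  rw [Matrix.transpose_mul, hs, Matrix.mul_assoc, ← Matrix.mul_assoc P, Matrix.mul_sub, hi]
  simp

lemma norm_transpose_mul_le [DecidableEq m] [DecidableEq p] {Q : Matrix m p ℝ} (hQ : Qᵀ * Q = 1)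
    (A : Matrix m n ℝ) : ‖Qᵀ * A‖ ≤ ‖A‖ := by
  have h := norm_sq_eq_add_of_proj (P := Q * Qᵀ) (by simp)
    (by rw [Matrix.mul_assoc, ← Matrix.mul_assoc Qᵀ, hQ, Matrix.one_mul]) A
  rw [Matrix.mul_assoc, norm_mul_of_transpose_mul_self hQ] at h
  exact (pow_le_pow_iff_left₀ (norm_nonneg _) (norm_nonneg _) two_ne_zero).1
    (by nlinarith [sq_nonneg ‖(1 - Q * Qᵀ) * A‖])

/-- The column space of a matrix `C` has an orthonormal basis: a matrix `V` with orthonormal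
columns, each of them a combination of the columns of `C`, whose projection `V Vᵀ` fixes `C`. -/
lemma exists_orthonormal_range {m n : ℕ} (C : Matrix (Fin m) (Fin n) ℝ) :
    ∃ V : Matrix (Fin m) (Fin C.rank) ℝ, Vᵀ * V = 1 ∧ V * (Vᵀ * C) = C ∧
      ∃ S : Matrix (Fin n) (Fin C.rank) ℝ, V = C * S := by
  let E := EuclideanSpace ℝ (Fin m)
  let R : Submodule ℝ E := (C.mulVecLin.range).map
    (WithLp.linearEquiv 2 ℝ (Fin m → ℝ)).symm.toLinearMap
  have hR : Module.finrank ℝ R = C.rank := by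
    rw [LinearEquiv.finrank_map_eq]; rfl
  let b := (stdOrthonormalBasis ℝ R).reindex (finCongr hR)
  have hmem : ∀ k, ∃ x : Fin n → ℝ, ∀ i, (b k : E) i = (C *ᵥ x) i := by
    intro k
    obtain ⟨y, ⟨x, hx⟩, hy⟩ := (b k).2
    refine ⟨x, fun i => ?_⟩
    rw [← hy, ← hx]; rfl
  choose S hS using hmem
  let V : Matrix (Fin m) (Fin C.rank) ℝ := Matrix.of fun i k => (b k : E) i
  refine ⟨V, ?_, ?_, Matrix.of fun i k => S k i, ?_⟩
  · ext k l
    have h := orthonormal_iff_ite.1 b.orthonormal k l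
    rw [Submodule.coe_inner, PiLp.inner_apply] at h
    rw [Matrix.mul_apply, Matrix.one_apply, ← h]
    exact Finset.sum_congr rfl fun i _ => by simp [V, mul_comm]
  · have hcol : ∀ j, WithLp.toLp 2 (C.col j) ∈ R := by
      intro j
      refine ⟨C.col j, ⟨Pi.single j 1, ?_⟩, rfl⟩
      simp
    ext i j
    have h := b.sum_repr' ⟨_, hcol j⟩
    have h2 := congrArg (fun z : R => EuclideanSpace.proj (𝕜 := ℝ) i (z : E)) h
    simp only [Submodule.coe_sum, Submodule.coe_smul, Submodule.coe_inner, map_sum, map_smul,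
      smul_eq_mul] at h2
    rw [Matrix.mul_apply]
    refine Eq.trans ?_ h2
    refine Finset.sum_congr rfl fun k _ => ?_
    rw [mul_comm, Matrix.mul_apply, PiLp.inner_apply]
    congr 1
    exact Finset.sum_congr rfl fun i _ => by simp [V, mul_comm]
  · ext i k
    simp only [V, Matrix.of_apply, hS k i]
    rfl

end Frobenius

/-! ### Matrices with independent columns and their left inverses -/

section LeftInverse

variable {m p q : Type*} [Fintype m] [Fintype p] [DecidableEq p]

/-- The left inverse `(Yᵀ Y)⁻¹ Yᵀ`. It is the pseudoinverse of `Y` if `Y` has independent columns,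
that is, if `det (Yᵀ Y) ≠ 0`. -/
noncomputable def leftInv (Y : Matrix m p ℝ) : Matrix p m ℝ := (Yᵀ * Y)⁻¹ * Yᵀ

lemma leftInv_mul {Y : Matrix m p ℝ} (hY : (Yᵀ * Y).det ≠ 0) : leftInv Y * Y = 1 := by
  rw [leftInv, Matrix.mul_assoc, Matrix.nonsing_inv_mul _ (isUnit_iff_ne_zero.2 hY)]

lemma det_gram_ne_zero_iff {Y : Matrix m p ℝ} :
    (Yᵀ * Y).det ≠ 0 ↔ ∀ x, Y *ᵥ x = 0 → x = 0 := by
  rw [Ne, ← Matrix.exists_mulVec_eq_zero_iff]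
  have h := Matrix.ker_mulVecLin_transpose_mul_self Y
  have h2 : ∀ x, (Yᵀ * Y) *ᵥ x = 0 ↔ Y *ᵥ x = 0 := fun x => by
    simpa only [LinearMap.mem_ker, Matrix.mulVecLin_apply] using SetLike.ext_iff.1 h x
  constructor
  · intro h3 x hx
    by_contra hne
    exact h3 ⟨x, hne, (h2 x).2 hx⟩
  · rintro h3 ⟨x, hne, hx⟩
    exact hne (h3 x ((h2 x).1 hx))

lemma gram_inv_symm (Y : Matrix m p ℝ) : ((Yᵀ * Y)⁻¹)ᵀ = (Yᵀ * Y)⁻¹ := by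
  rw [Matrix.transpose_nonsing_inv, Matrix.transpose_mul, Matrix.transpose_transpose]

/-- The matrix `Y (Yᵀ Y)⁻¹ Yᵀ` of the orthogonal projection onto the column space of `Y`, if the
columns of `Y` are independent. -/
noncomputable def colProj (Y : Matrix m p ℝ) : Matrix m m ℝ := Y * leftInv Y

lemma colProj_transpose (Y : Matrix m p ℝ) : (colProj Y)ᵀ = colProj Y := by
  simp only [colProj, leftInv, Matrix.transpose_mul, Matrix.transpose_transpose, gram_inv_symm,
    Matrix.mul_assoc]

lemma colProj_mul {Y : Matrix m p ℝ} (hY : (Yᵀ * Y).det ≠ 0) : colProj Y * Y = Y := by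
  rw [colProj, Matrix.mul_assoc, leftInv_mul hY, Matrix.mul_one]

lemma colProj_mul_self {Y : Matrix m p ℝ} (hY : (Yᵀ * Y).det ≠ 0) :
    colProj Y * colProj Y = colProj Y := by
  conv_lhs => rw [colProj, Matrix.mul_assoc, ← Matrix.mul_assoc (leftInv Y), leftInv_mul hY,
    Matrix.one_mul, ← colProj]

/-- If `G` has independent columns, maps of the form `F Gᵀ` are determined by their values on the
columns of `G`. -/
lemma mul_eq_of_factor {G : Matrix m p ℝ} (hG : (Gᵀ * G).det ≠ 0) {F F' : Matrix q p ℝ}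
    (h : F * Gᵀ * G = F' * Gᵀ * G) : F * Gᵀ = F' * Gᵀ := by
  rw [Matrix.mul_assoc, Matrix.mul_assoc] at h
  have := congrArg (· * (Gᵀ * G)⁻¹) h
  simp only [Matrix.mul_assoc _ (Gᵀ * G), Matrix.mul_nonsing_inv _ (isUnit_iff_ne_zero.2 hG),
    Matrix.mul_one] at this
  rw [this]

/-- The oblique projection `Y (Ψ Y)† Ψ` onto the column space of `Y`, whose kernel contains that of
`Ψ`. It is a projection if the columns of `Ψ Y` are independent. -/
noncomputable def obliqueProj {m p l : Type*} [Fintype m] [Fintype p] [Fintype l] [DecidableEq p]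
    (Y : Matrix m p ℝ) (Psi : Matrix l m ℝ) : Matrix m m ℝ :=
  Y * leftInv (Psi * Y) * Psi

lemma isPseudoinverse_leftInv {l k : ℕ} {G : Matrix (Fin l) (Fin k) ℝ} (hG : (Gᵀ * G).det ≠ 0) :
    IsPseudoinverse G (leftInv G) where
  mul_mul_self := by rw [Matrix.mul_assoc, leftInv_mul hG, Matrix.mul_one]
  self_mul_mul := by rw [leftInv_mul hG, Matrix.one_mul]
  symm_left := colProj_transpose G
  symm_right := by rw [leftInv_mul hG, Matrix.transpose_one]

lemma IsPseudoinverse.mul_eq_one {l k : ℕ} {G : Matrix (Fin l) (Fin k) ℝ}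
    {P : Matrix (Fin k) (Fin l) ℝ} (h : IsPseudoinverse G P) (hG : ∀ x, G *ᵥ x = 0 → x = 0) :
    P * G = 1 := by
  have hG' := det_gram_ne_zero_iff.2 hG
  have h1 := congrArg (leftInv G * ·) h.mul_mul_self
  simp only [← Matrix.mul_assoc, leftInv_mul hG', Matrix.one_mul] at h1
  exact h1

/-- The matrix `Q (Ψ Q)†` is the same for all matrices `Q` with independent columns that span a
given space on which `Ψ` is injective. In particular, the oblique projection depends only on the
column space of `Y`. -/
lemma mul_pseudoinverse_mul_eq {l m k p : ℕ} {Psi : Matrix (Fin l) (Fin m) ℝ}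
    {Y : Matrix (Fin m) (Fin k) ℝ} (hG : ((Psi * Y)ᵀ * (Psi * Y)).det ≠ 0)
    {Q : Matrix (Fin m) (Fin p) ℝ} {P : Matrix (Fin p) (Fin l) ℝ}
    {S : Matrix (Fin k) (Fin p) ℝ} {S' : Matrix (Fin p) (Fin k) ℝ}
    (hQS : Q = Y * S) (hYS : Y = Q * S') (hQ : ∀ x, Q *ᵥ x = 0 → x = 0)
    (hP : IsPseudoinverse (Psi * Q) P) : Q * P = Y * leftInv (Psi * Y) := by
  have hinj : ∀ x, (Psi * Q) *ᵥ x = 0 → x = 0 := by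
    intro x hx
    refine hQ x ?_
    rw [hQS, ← Matrix.mul_assoc, ← Matrix.mulVec_mulVec] at hx
    rw [hQS, ← Matrix.mulVec_mulVec, det_gram_ne_zero_iff.1 hG _ hx, Matrix.mulVec_zero]
  have h1 := hP.mul_eq_one hinj
  have h2 : Q * P = Q * P * Pᵀ * Sᵀ * (Psi * Y)ᵀ := by
    have h3 : P * (Psi * Q * P)ᵀ = P := by rw [hP.symm_left, ← Matrix.mul_assoc, hP.self_mul_mul]
    conv_lhs => rw [← h3, hQS]
    simp only [Matrix.transpose_mul, Matrix.mul_assoc, hQS]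
  rw [h2, leftInv, ← Matrix.mul_assoc]
  refine mul_eq_of_factor hG ?_
  rw [← h2, Matrix.mul_assoc Y _ _, ← leftInv, Matrix.mul_assoc Y, leftInv_mul hG, Matrix.mul_one]
  conv_lhs => rw [hYS]
  rw [Matrix.mul_assoc, ← Matrix.mul_assoc Psi, ← Matrix.mul_assoc P, h1, Matrix.one_mul, ← hYS]

end LeftInverse

/-! ### Best rank-`r` approximations -/

section BestApprox

variable {m n r : ℕ} {M D X : Matrix (Fin m) (Fin n) ℝ}

lemma isClosed_setOf_rank_le (m n r : ℕ) :
    IsClosed {D : Matrix (Fin m) (Fin n) ℝ | D.rank ≤ r} := by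
  let T : Matrix (Fin m) (Fin n) ℝ →ₗ[ℝ] ((Fin n → ℝ) →L[ℝ] (Fin m → ℝ)) :=
    LinearMap.toContinuousLinearMap.toLinearMap ∘ₗ Matrix.toLin'.toLinearMap
  have hT : Continuous T := T.continuous_of_finiteDimensional
  rw [← isOpen_compl_iff]
  convert (isOpen_setOfPred_nat_le_rank (r + 1)).preimage hT using 1
  ext D
  have h : ((T D : (Fin n → ℝ) →L[ℝ] (Fin m → ℝ)) : (Fin n → ℝ) →ₗ[ℝ] (Fin m → ℝ)).rank
      = (D.rank : Cardinal) := by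
    exact (Module.finrank_eq_rank ℝ D.mulVecLin.range).symm
  change ¬ (D.rank ≤ r) ↔ (((r + 1 : ℕ) : Cardinal) ≤ _)
  rw [h, Nat.cast_le]
  omega

lemma exists_isBestRankApprox (r : ℕ) (M : Matrix (Fin m) (Fin n) ℝ) :
    ∃ D, IsBestRankApprox r M D := by
  obtain ⟨D, hD, h⟩ := (isClosed_setOf_rank_le m n r).exists_infDist_eq_dist
    ⟨0, by simp⟩ M
  refine ⟨D, hD, fun D' hD' => ?_⟩
  rw [← dist_eq_norm, ← dist_eq_norm, ← h]
  exact Metric.infDist_le_dist_of_mem hD'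

lemma IsBestRankApprox.norm_sub_eq_infDist (h : IsBestRankApprox r M D) :
    ‖M - D‖ = Metric.infDist M {D : Matrix (Fin m) (Fin n) ℝ | D.rank ≤ r} := by
  refine le_antisymm ?_ ?_
  · exact (Metric.le_infDist ⟨D, h.1⟩).2 fun D' hD' => by
      rw [dist_eq_norm]; exact h.2 D' hD'
  · rw [← dist_eq_norm]; exact Metric.infDist_le_dist_of_mem h.1

lemma IsBestRankApprox.transpose (h : IsBestRankApprox r M D) : IsBestRankApprox r Mᵀ Dᵀ := by
  refine ⟨by rw [Matrix.rank_transpose]; exact h.1, fun D' hD' => ?_⟩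
  rw [← Matrix.transpose_sub, Matrix.frobenius_norm_transpose,
    ← Matrix.frobenius_norm_transpose (Mᵀ - D'), Matrix.transpose_sub, Matrix.transpose_transpose]
  exact h.2 _ (by rw [Matrix.rank_transpose]; exact hD')

/-- The residual of a best approximation `D` is orthogonal to the column space of `D`: otherwise
some `D (1 + t W)`, whose rank is at most that of `D`, would be closer to `M`. -/
lemma IsBestRankApprox.transpose_mul_sub (h : IsBestRankApprox r M D) : Dᵀ * (M - D) = 0 := by
  set R := M - D with hR
  set W := Dᵀ * R
  have key : ∀ t : ℝ, 0 ≤ ‖D * W‖ ^ 2 * (t * t) + (-2 * ‖W‖ ^ 2) * t + 0 := by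
    intro t
    have h1 := h.2 (D + t • (D * W)) (by
      have : D + t • (D * W) = D * (1 + t • W) := by
        rw [Matrix.mul_add, Matrix.mul_one, Matrix.mul_smul]
      rw [this]
      exact (Matrix.rank_mul_le_left _ _).trans h.1)
    have h2 : M - (D + t • (D * W)) = R + (-t) • (D * W) := by rw [hR]; simp; abel
    have h3 : (Rᵀ * (D * W)).trace = ‖W‖ ^ 2 := by
      rw [norm_sq_eq_trace, ← Matrix.mul_assoc]; simp [W]
    have h4 := pow_le_pow_left₀ (norm_nonneg _) h1 2
    rw [h2, norm_add_sq_eq, Matrix.mul_smul, Matrix.trace_smul, h3, norm_smul, mul_pow,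
      Real.norm_eq_abs, sq_abs, smul_eq_mul] at h4
    nlinarith
  have := discrim_le_zero key
  rw [discrim] at this
  have hW : ‖W‖ = 0 := by
    have : (‖W‖ ^ 2) ^ 2 ≤ 0 := by nlinarith
    exact pow_eq_zero_iff two_ne_zero |>.1
      (pow_eq_zero_iff two_ne_zero |>.1 (le_antisymm this (by positivity)))
  exact norm_eq_zero.1 hW

lemma IsBestRankApprox.sub_mul_transpose (h : IsBestRankApprox r M D) : (M - D) * Dᵀ = 0 := by
  have := congrArg Matrix.transpose h.transpose.transpose_mul_sub
  simpa using this

/-- A projection that fixes `M` fixes its best approximations. -/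
lemma IsBestRankApprox.proj_mul (h : IsBestRankApprox r M D) {P : Matrix (Fin m) (Fin m) ℝ}
    (hs : Pᵀ = P) (hi : P * P = P) (hM : P * M = M) : P * D = D := by
  have h1 := h.2 (P * D) ((Matrix.rank_mul_le_right _ _).trans h.1)
  have h2 := norm_sq_eq_add_of_proj hs hi (M - D)
  have h3 : (1 - P) * (M - D) = P * D - D := by
    rw [Matrix.sub_mul, Matrix.one_mul, Matrix.mul_sub, hM]; abel
  rw [Matrix.mul_sub, hM, h3] at h2
  have h4 := pow_le_pow_left₀ (norm_nonneg _) h1 2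
  have : ‖P * D - D‖ = 0 := by
    rw [← pow_eq_zero_iff two_ne_zero]
    nlinarith [sq_nonneg ‖P * D - D‖]
  exact sub_eq_zero.1 (norm_eq_zero.1 this)

lemma IsBestRankApprox.norm_le (h : IsBestRankApprox r M D) : ‖D‖ ≤ 2 * ‖M‖ := by
  have h1 := h.2 0 (by simp)
  rw [sub_zero] at h1
  calc ‖D‖ = ‖M - (M - D)‖ := by rw [sub_sub_cancel]
    _ ≤ ‖M‖ + ‖M - D‖ := norm_sub_le _ _
    _ ≤ _ := by linarith

lemma IsBestRankApprox.mul_isometry {p : ℕ} {Q : Matrix (Fin m) (Fin p) ℝ} (hQ : Qᵀ * Q = 1)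
    {B C : Matrix (Fin p) (Fin n) ℝ} (h : IsBestRankApprox r B C) :
    IsBestRankApprox r (Q * B) (Q * C) := by
  refine ⟨(Matrix.rank_mul_le_right _ _).trans h.1, fun D hD => ?_⟩
  have h1 := h.2 (Qᵀ * D) ((Matrix.rank_mul_le_right _ _).trans hD)
  have h2 := norm_transpose_mul_le hQ (Q * B - D)
  rw [Matrix.mul_sub, ← Matrix.mul_assoc, hQ, Matrix.one_mul] at h2
  rw [← Matrix.mul_sub, norm_mul_of_transpose_mul_self hQ]
  exact h1.trans h2

/-- A best approximation of a perturbation `M` of `X` is a nearly best approximation of `X`. -/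
lemma IsBestRankApprox.abs_norm_sub_le {Xr : Matrix (Fin m) (Fin n) ℝ}
    (h : IsBestRankApprox r M D) (hX : IsBestRankApprox r X Xr) :
    |‖D - X‖ - ‖X - Xr‖| ≤ 2 * ‖M - X‖ := by
  have h1 := hX.2 D h.1
  have h2 := h.2 Xr hX.1
  have h3 : ‖D - X‖ ≤ ‖M - D‖ + ‖M - X‖ := by
    have := norm_sub_le (M - X) (M - D)
    rw [sub_sub_sub_cancel_left] at this; linarith
  have h4 : ‖M - Xr‖ ≤ ‖M - X‖ + ‖X - Xr‖ := by
    have := norm_add_le (M - X) (X - Xr)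
    rwa [sub_add_sub_cancel] at this
  rw [norm_sub_rev D X] at *
  rw [abs_le]
  constructor <;> linarith [norm_nonneg (M - X)]

/-- Error bound for truncated projections: `M = Π A + E` approximates `A`, where `Π` is an
orthogonal projection, and `D` is a best rank-`r` approximation of `M`. For any competitor `Z` of
rank at most `r` in the range of `Π`, the error of `D` exceeds that of `Z` by at most `2 ‖E‖`. -/
lemma IsBestRankApprox.norm_sub_le_of_proj {A E Z : Matrix (Fin m) (Fin n) ℝ}
    {P : Matrix (Fin m) (Fin m) ℝ} (hs : Pᵀ = P) (hi : P * P = P) (hE : P * E = E)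
    (hZ : P * Z = Z) (hZr : Z.rank ≤ r) (h : IsBestRankApprox r (P * A + E) D) :
    ‖A - D‖ ≤ ‖A - Z‖ + 2 * ‖E‖ := by
  have hM : P * (P * A + E) = P * A + E := by rw [Matrix.mul_add, ← Matrix.mul_assoc, hi, hE]
  have hD := h.proj_mul hs hi hM
  have split : ∀ C : Matrix (Fin m) (Fin n) ℝ, P * C = C →
      ‖A - C‖ ^ 2 = ‖P * A - C‖ ^ 2 + ‖(1 - P) * A‖ ^ 2 := by
    intro C hC
    rw [norm_sq_eq_add_of_proj hs hi, Matrix.mul_sub, hC, Matrix.mul_sub, Matrix.sub_mul _ _ C, hC]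
    simp
  have h1 := split D hD
  have h2 := split Z hZ
  have h3 : ‖P * A - D‖ ≤ ‖P * A - Z‖ + 2 * ‖E‖ := by
    have e1 := norm_sub_le (P * A + E - D) E
    have e2 := norm_add_le (P * A - Z) E
    have e3 := h.2 Z hZr
    rw [show P * A + E - D - E = P * A - D by abel] at e1
    rw [show P * A - Z + E = P * A + E - Z by abel] at e2
    linarith
  have h4 : ‖P * A - Z‖ ≤ ‖A - Z‖ := by
    refine (pow_le_pow_iff_left₀ (norm_nonneg _) (norm_nonneg _) two_ne_zero).1 ?_
    nlinarith [sq_nonneg ‖(1 - P) * A‖]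
  refine (pow_le_pow_iff_left₀ (norm_nonneg _) (by positivity) two_ne_zero).1 ?_
  have h5 := pow_le_pow_left₀ (norm_nonneg _) h3 2
  nlinarith [norm_nonneg E]

lemma isClosed_setOf_isBestRankApprox (m n r : ℕ) :
    IsClosed {q : Matrix (Fin m) (Fin n) ℝ × Matrix (Fin m) (Fin n) ℝ |
      IsBestRankApprox r q.1 q.2} := by
  have : {q : Matrix (Fin m) (Fin n) ℝ × Matrix (Fin m) (Fin n) ℝ | IsBestRankApprox r q.1 q.2} =
      Prod.snd ⁻¹' {D | D.rank ≤ r} ∩ ⋂ D ∈ {D : Matrix (Fin m) (Fin n) ℝ | D.rank ≤ r},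
        {q | ‖q.1 - q.2‖ ≤ ‖q.1 - D‖} := by
    ext q; simp [IsBestRankApprox]
  rw [this]
  refine ((isClosed_setOf_rank_le m n r).preimage continuous_snd).inter ?_
  refine isClosed_biInter fun D _ => isClosed_le ?_ ?_ <;> fun_prop

/-- If the best approximations of `M` all have the same distance to `X`, this distance is the limit
of the distances of best approximations of matrices converging to `M`. -/
lemma tendsto_norm_sub_of_isBestRankApprox {Mt Dt : ℕ → Matrix (Fin m) (Fin n) ℝ}
    (hM : Tendsto Mt atTop (𝓝 M)) (hD : ∀ t, IsBestRankApprox r (Mt t) (Dt t))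
    (huniq : ∀ D', IsBestRankApprox r M D' → ‖D' - X‖ = ‖D - X‖) :
    Tendsto (fun t => ‖Dt t - X‖) atTop (𝓝 ‖D - X‖) := by
  refine tendsto_of_subseq_tendsto fun ns hns => ?_
  obtain ⟨B, hB⟩ := (hM.norm.isBoundedUnder_le).bddAbove_range
  have hbd : ∀ t, Dt t ∈ Metric.closedBall (0 : Matrix (Fin m) (Fin n) ℝ) (2 * B) := fun t => by
    rw [mem_closedBall_zero_iff]
    exact (hD t).norm_le.trans (by linarith [hB ⟨t, rfl⟩])
  obtain ⟨D', -, φ, hφ, hlim⟩ := (isCompact_closedBall (0 : Matrix (Fin m) (Fin n) ℝ)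
    (2 * B)).tendsto_subseq fun t => hbd (ns t)
  refine ⟨φ, ?_⟩
  have hM' : Tendsto (fun t => Mt (ns (φ t))) atTop (𝓝 M) := hM.comp (hns.comp hφ.tendsto_atTop)
  have hD' : IsBestRankApprox r M D' :=
    ⟨(isClosed_setOf_rank_le m n r).mem_of_tendsto hlim (Eventually.of_forall fun t => (hD _).1),
      fun C hC => le_of_tendsto_of_tendsto' (hM'.sub hlim).norm (hM'.sub_const C).norm
        fun t => (hD _).2 C hC⟩
  rw [← huniq D' hD']
  exact (hlim.sub_const X).norm

/-- The matrices `M` whose best approximations do not all have the same distance to `X`. -/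
def ambiguousSet (r : ℕ) (X : Matrix (Fin m) (Fin n) ℝ) : Set (Matrix (Fin m) (Fin n) ℝ) :=
  {M | ∃ D D', IsBestRankApprox r M D ∧ IsBestRankApprox r M D' ∧ ‖D - X‖ ≠ ‖D' - X‖}

/-- `ambiguousSet r X` is a countable union of closed sets, namely of projections of compact sets of
triples `(M, D, D')`. Hence it is measurable. -/
lemma exists_isClosed_ambiguousSet (r : ℕ) (X : Matrix (Fin m) (Fin n) ℝ) :
    ∃ K : ℕ × ℕ → Set (Matrix (Fin m) (Fin n) ℝ), (∀ i, IsClosed (K i)) ∧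
      ambiguousSet r X = ⋃ i, K i := by
  let MM := Matrix (Fin m) (Fin n) ℝ
  let C : ℕ × ℕ → Set (MM × (MM × MM)) := fun i =>
    {q | IsBestRankApprox r q.1 q.2.1 ∧ IsBestRankApprox r q.1 q.2.2 ∧
      1 / ((i.1 : ℝ) + 1) ≤ |‖q.2.1 - X‖ - ‖q.2.2 - X‖|} ∩
    Metric.closedBall 0 i.2 ×ˢ (Metric.closedBall 0 (2 * i.2) ×ˢ Metric.closedBall 0 (2 * i.2))
  have hC : ∀ i, IsCompact (C i) := by
    intro i
    refine ((isCompact_closedBall _ _).prod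
      ((isCompact_closedBall _ _).prod (isCompact_closedBall _ _))).inter_left ?_
    refine IsClosed.inter ?_ (IsClosed.inter ?_ ?_)
    · exact (isClosed_setOf_isBestRankApprox m n r).preimage
        (f := fun q : MM × (MM × MM) => (q.1, q.2.1)) (by fun_prop)
    · exact (isClosed_setOf_isBestRankApprox m n r).preimage
        (f := fun q : MM × (MM × MM) => (q.1, q.2.2)) (by fun_prop)
    · exact isClosed_le (f := fun _ : MM × (MM × MM) => 1 / ((i.1 : ℝ) + 1))
        (g := fun q : MM × (MM × MM) => |‖q.2.1 - X‖ - ‖q.2.2 - X‖|) (by fun_prop) (by fun_prop)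
  refine ⟨fun i => Prod.fst '' C i, fun i => ((hC i).image continuous_fst).isClosed, ?_⟩
  ext M
  simp only [Set.mem_iUnion, Set.mem_image]
  constructor
  · rintro ⟨D, D', hD, hD', hne⟩
    obtain ⟨k, hk⟩ := exists_nat_one_div_lt (abs_pos.2 (sub_ne_zero.2 hne))
    obtain ⟨R, hR⟩ := exists_nat_ge ‖M‖
    refine ⟨(k, R), (M, D, D'), ⟨⟨hD, hD', hk.le⟩, ?_⟩, rfl⟩
    simp only [Set.mem_prod, mem_closedBall_zero_iff]
    exact ⟨hR, hD.norm_le.trans (by linarith), hD'.norm_le.trans (by linarith)⟩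
  · rintro ⟨i, ⟨M', D, D'⟩, ⟨⟨hD, hD', hne⟩, -⟩, rfl⟩
    refine ⟨D, D', hD, hD', fun h => ?_⟩
    simp only [h, sub_self, abs_zero] at hne
    exact absurd hne (not_le.2 (by positivity))

/-- Along a line `θ ↦ C + θ E`, almost no matrix is ambiguous for `X`, if `X` and `C` have the same
inner product with the best approximations of the matrices on the line. Indeed, the distance of
`C + θ E` to the matrices of rank at most `r` is Lipschitz, hence differentiable for almost every
`θ`, and its derivative reveals the inner product of `E` with the best approximations `D`;
together with `⟨C + θ E, D⟩ = ‖D‖²` this determines `⟨C, D⟩`, and so `‖D - X‖`. -/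
lemma ae_notMem_ambiguousSet {C E : Matrix (Fin m) (Fin n) ℝ}
    (hX : ∀ θ : ℝ, ∀ D, IsBestRankApprox r (C + θ • E) D →
      (Xᵀ * D).trace = (Cᵀ * D).trace) :
    ∀ᵐ θ : ℝ, C + θ • E ∉ ambiguousSet r X := by
  let S : Set (Matrix (Fin m) (Fin n) ℝ) := {D | D.rank ≤ r}
  have hlip : LipschitzWith (1 * ‖E‖₊) fun θ : ℝ => Metric.infDist (C + θ • E) S := by
    refine (Metric.lipschitz_infDist_pt S).comp (LipschitzWith.of_dist_le_mul fun a b => ?_)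
    rw [dist_add_left, dist_eq_norm, ← sub_smul, norm_smul, mul_comm]; rfl
  filter_upwards [hlip.ae_differentiableAt_real] with θ hθ
  rintro ⟨D, D', hD, hD', hne⟩
  set g : ℝ → ℝ := fun θ => Metric.infDist (C + θ • E) S ^ 2
  have hg : DifferentiableAt ℝ g θ := hθ.pow 2
  have hder : ∀ D, IsBestRankApprox r (C + θ • E) D →
      deriv g θ = 2 * (Eᵀ * (C + θ • E - D)).trace := by
    intro D hD
    set R := C + θ • E - D with hR
    let q : ℝ → ℝ := fun s => ‖R‖ ^ 2 + 2 * (s - θ) * (Eᵀ * R).trace + (s - θ) ^ 2 * ‖E‖ ^ 2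
    have hq : ∀ s, ‖C + s • E - D‖ ^ 2 = q s := by
      intro s
      have : C + s • E - D = (s - θ) • E + R := by rw [hR, sub_smul]; abel
      rw [this, norm_add_sq_eq, norm_smul, mul_pow, Real.norm_eq_abs, sq_abs,
        Matrix.transpose_smul, Matrix.smul_mul, Matrix.trace_smul, smul_eq_mul]
      simp only [q]; ring
    have hqd : HasDerivAt q (2 * (Eᵀ * R).trace) θ := by
      have h1 : HasDerivAt (fun s : ℝ => s - θ) 1 θ := (hasDerivAt_id θ).sub_const θ
      have h2 := ((((h1.const_mul 2).mul_const (Eᵀ * R).trace).const_add (‖R‖ ^ 2))).add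
        ((h1.pow 2).mul_const (‖E‖ ^ 2))
      exact h2.congr_deriv (by ring)
    -- The squared distance to `D` is a quadratic function `q ≥ g` that touches `g` at `θ`.
    have hmin : IsLocalMin (fun s => q s - g s) θ := by
      refine Eventually.of_forall fun s => ?_
      have e1 : q θ - g θ = 0 := by
        rw [← hq θ]; simp only [g]
        rw [hD.norm_sub_eq_infDist]; exact sub_self _
      have e2 : g s ≤ q s := by
        rw [← hq s, ← dist_eq_norm]
        exact pow_le_pow_left₀ Metric.infDist_nonneg (Metric.infDist_le_dist_of_mem (s := S) hD.1) 2
      change q θ - g θ ≤ q s - g s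
      linarith
    have := hmin.hasDerivAt_eq_zero (hqd.sub hg.hasDerivAt)
    linarith
  have hval : ∀ D, IsBestRankApprox r (C + θ • E) D → ‖D - X‖ ^ 2 =
      ‖X‖ ^ 2 - ‖C + θ • E‖ ^ 2 + g θ +
        θ * (2 * (Eᵀ * (C + θ • E)).trace - deriv g θ) := by
    intro D hD
    have e1 : ‖D - X‖ ^ 2 = ‖X‖ ^ 2 - 2 * (Xᵀ * D).trace + ‖D‖ ^ 2 := by
      rw [norm_sub_rev, sub_eq_add_neg, norm_add_sq_eq, norm_neg, Matrix.mul_neg,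
        Matrix.trace_neg]; ring
    have e2 : ‖C + θ • E‖ ^ 2 = ‖D‖ ^ 2 + g θ := by
      have := norm_add_sq_of_transpose_mul_eq_zero hD.transpose_mul_sub
      rw [add_sub_cancel, hD.norm_sub_eq_infDist] at this
      exact this
    have e3 : (Cᵀ * D).trace + θ * (Eᵀ * D).trace = ‖D‖ ^ 2 := by
      have := congrArg (fun Z => Zᵀ.trace) hD.transpose_mul_sub
      simp only [Matrix.transpose_mul, Matrix.transpose_transpose, Matrix.transpose_sub,
        Matrix.sub_mul, Matrix.transpose_add, Matrix.add_mul, Matrix.transpose_smul,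
        Matrix.smul_mul, Matrix.trace_sub, Matrix.trace_add, Matrix.trace_smul, smul_eq_mul,
        Matrix.transpose_zero, Matrix.trace_zero] at this
      rw [norm_sq_eq_trace]; linarith
    have e4 := hder D hD
    rw [Matrix.mul_sub, Matrix.trace_sub] at e4
    have e5 := hX θ D hD
    rw [e1, e4, e5, e2]
    linear_combination (-2) * e3
  apply hne
  rw [← sq_eq_sq₀ (norm_nonneg _) (norm_nonneg _), hval D hD, hval D' hD']

end BestApprox

/-! ### The sketch of the iterates and the reconstruction -/

section Sketch

variable {m n d r : ℕ}

lemma measure_add_smul (A : Fin d → Matrix (Fin m) (Fin n) ℝ) (a b : ℝ)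
    (X H : Matrix (Fin m) (Fin n) ℝ) :
    SketchyCGM.measure A (a • X + b • H) =
      a • SketchyCGM.measure A X + b • SketchyCGM.measure A H := by
  ext i
  simp only [SketchyCGM.measure, Matrix.add_apply, Matrix.smul_apply, smul_eq_mul, PiLp.add_apply,
    PiLp.smul_apply, Finset.mul_sum, ← Finset.sum_add_distrib]
  exact Finset.sum_congr rfl fun _ _ => Finset.sum_congr rfl fun _ _ => by ring

/-- By linearity, SketchyCGM maintains the sketch of the iterates of the conditional gradient
method. -/
lemma sketchyCGM_eq (A : Fin d → Matrix (Fin m) (Fin n) ℝ)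
    (f : EuclideanSpace ℝ (Fin d) → ℝ) (α : ℝ)
    (maxSingVec : ℕ → Matrix (Fin m) (Fin n) ℝ → (Fin m → ℝ) × (Fin n → ℝ))
    (Om : Matrix (Fin n) (Fin (2 * r + 1)) ℝ) (Psi : Matrix (Fin (4 * r + 3)) (Fin m) ℝ) (t : ℕ) :
    sketchyCGM A f α maxSingVec Om Psi t =
      ⟨SketchyCGM.measure A (cgm A f α maxSingVec t), cgm A f α maxSingVec t * Om,
        Psi * cgm A f α maxSingVec t⟩ := by
  induction t with
  | zero =>
    simp only [sketchyCGM, cgm, Matrix.zero_mul, Matrix.mul_zero, State.mk.injEq, and_self,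
      and_true]
    ext i; simp [SketchyCGM.measure]
  | succ t ih =>
    simp only [sketchyCGM, cgm, ih, measure_add_smul, Matrix.add_mul, Matrix.mul_add,
      Matrix.smul_mul, Matrix.mul_smul]

lemma exists_eq_mul_of_span_le {k p : ℕ} {Q : Matrix (Fin m) (Fin p) ℝ}
    {Y : Matrix (Fin m) (Fin k) ℝ}
    (h : Submodule.span ℝ (Set.range Q.col) ≤ Submodule.span ℝ (Set.range Y.col)) :
    ∃ S : Matrix (Fin k) (Fin p) ℝ, Q = Y * S := by
  have h1 : ∀ j, ∃ x, Y *ᵥ x = Q.col j := fun j => by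
    have := h (Submodule.subset_span ⟨j, rfl⟩)
    rwa [← Matrix.range_mulVecLin] at this
  choose S hS using h1
  refine ⟨Matrix.of fun a j => S j a, ?_⟩
  ext i j
  exact (congrFun (hS j) i).symm

lemma mulVec_eq_zero_of_transpose_mul_self {m p : Type*} [Fintype m] [Fintype p] [DecidableEq p]
    {Q : Matrix m p ℝ} (hQ : Qᵀ * Q = 1) (x : p → ℝ) (hx : Q *ᵥ x = 0) : x = 0 := by
  rw [← Matrix.one_mulVec x, ← hQ, ← Matrix.mulVec_mulVec, hx, Matrix.mulVec_zero]

lemma det_gram_ne_zero_of_mul {l m k : Type*} [Fintype l] [Fintype m] [Fintype k] [DecidableEq k]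
    {Psi : Matrix l m ℝ} {Y : Matrix m k ℝ} (h : ((Psi * Y)ᵀ * (Psi * Y)).det ≠ 0) :
    (Yᵀ * Y).det ≠ 0 :=
  det_gram_ne_zero_iff.2 fun x hx => det_gram_ne_zero_iff.1 h x (by
    rw [← Matrix.mulVec_mulVec, hx, Matrix.mulVec_zero])

/-- Whatever the choice of the basis `Q`, a reconstruction is a best rank-`r` approximation of
`Y (Ψ Y)† W`. -/
lemma IsReconstruction.isBestRankApprox {k l : ℕ} {Psi : Matrix (Fin l) (Fin m) ℝ}
    {Y : Matrix (Fin m) (Fin k) ℝ} {W : Matrix (Fin l) (Fin n) ℝ} {Xhat : Matrix (Fin m) (Fin n) ℝ}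
    (h : IsReconstruction r Psi Y W Xhat) (hG : ((Psi * Y)ᵀ * (Psi * Y)).det ≠ 0) :
    IsBestRankApprox r (Y * leftInv (Psi * Y) * W) Xhat := by
  obtain ⟨p, Q, P, B, hQ, hspan, hP, hB, rfl⟩ := h
  obtain ⟨S, hS⟩ := exists_eq_mul_of_span_le hspan.le
  obtain ⟨S', hS'⟩ := exists_eq_mul_of_span_le hspan.ge
  rw [← mul_pseudoinverse_mul_eq hG hS hS' (mulVec_eq_zero_of_transpose_mul_self hQ) hP,
    Matrix.mul_assoc]
  exact hB.mul_isometry hQ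

/-- If the range of the sketch `Y = A Ω` is that of `A`, and `Ψ` is injective on it, then nothing is
lost: `A` itself is recovered, up to the truncation. -/
lemma IsReconstruction.isBestRankApprox_self {k l p : ℕ} {Psi : Matrix (Fin l) (Fin m) ℝ}
    {A Xhat : Matrix (Fin m) (Fin n) ℝ} {Om : Matrix (Fin n) (Fin k) ℝ}
    {T : Matrix (Fin k) (Fin n) ℝ} {V : Matrix (Fin m) (Fin p) ℝ}
    (h : IsReconstruction r Psi (A * Om) (Psi * A) Xhat) (hT : A * Om * T = A)
    (hV : V * (Vᵀ * A) = A) (hG : ((Psi * V)ᵀ * (Psi * V)).det ≠ 0) :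
    IsBestRankApprox r A Xhat := by
  obtain ⟨p, Q, P, B, hQ, hspan, hP, hB, rfl⟩ := h
  obtain ⟨S, hS⟩ := exists_eq_mul_of_span_le hspan.le
  obtain ⟨S', hS'⟩ := exists_eq_mul_of_span_le hspan.ge
  have hinj : ∀ x, (Psi * Q) *ᵥ x = 0 → x = 0 := by
    intro x hx
    have hQV : Q = V * (Vᵀ * A * Om * S) := by
      conv_lhs => rw [hS, ← hV]
      simp only [Matrix.mul_assoc]
    rw [hQV, ← Matrix.mul_assoc, ← Matrix.mulVec_mulVec] at hx
    have := det_gram_ne_zero_iff.1 hG _ hx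
    refine mulVec_eq_zero_of_transpose_mul_self hQ x ?_
    rw [hQV, ← Matrix.mulVec_mulVec, this, Matrix.mulVec_zero]
  have h1 := hP.mul_eq_one hinj
  have hA : A = Q * (S' * T) := by rw [← Matrix.mul_assoc, ← hS', hT]
  have h2 : P * (Psi * A) = S' * T := by
    rw [hA, ← Matrix.mul_assoc, ← Matrix.mul_assoc, Matrix.mul_assoc P, h1, Matrix.one_mul]
  rw [h2] at hB
  conv => arg 2; rw [hA]
  exact hB.mul_isometry hQ

end Sketch

/-! ### The error of the oblique projection -/

section Error

variable {l m n k : Type*} [Fintype l] [Fintype m] [Fintype k] [DecidableEq k]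

lemma colProj_mul_obliqueProj_mul {Psi : Matrix l m ℝ} {Y : Matrix m k ℝ}
    (h : (Yᵀ * Y).det ≠ 0) (Z : Matrix m n ℝ) :
    colProj Y * (obliqueProj Y Psi * Z) = obliqueProj Y Psi * Z := by
  rw [obliqueProj, ← Matrix.mul_assoc, ← Matrix.mul_assoc, ← Matrix.mul_assoc, colProj_mul h]

variable [DecidableEq m]

/-- The oblique projection of `A` is its orthogonal projection plus an error, which is the oblique
projection of the residual. -/
lemma obliqueProj_mul_eq {Psi : Matrix l m ℝ} {Y : Matrix m k ℝ}
    (h : ((Psi * Y)ᵀ * (Psi * Y)).det ≠ 0) (A : Matrix m n ℝ) :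
    obliqueProj Y Psi * A = colProj Y * A + obliqueProj Y Psi * ((1 - colProj Y) * A) := by
  have : obliqueProj Y Psi * colProj Y = colProj Y := by
    rw [obliqueProj, colProj, Matrix.mul_assoc _ Psi, ← Matrix.mul_assoc Psi,
      ← Matrix.mul_assoc, Matrix.mul_assoc Y, leftInv_mul h, Matrix.mul_one]
  rw [Matrix.sub_mul, Matrix.one_mul, Matrix.mul_sub, ← Matrix.mul_assoc _ (colProj Y), this]
  abel

lemma transpose_mul_one_sub_colProj {Y : Matrix m k ℝ} (h : (Yᵀ * Y).det ≠ 0) (A : Matrix m n ℝ) :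
    Yᵀ * ((1 - colProj Y) * A) = 0 := by
  have : Yᵀ * colProj Y = Yᵀ := by
    have := congrArg Matrix.transpose (colProj_mul h)
    rwa [Matrix.transpose_mul, colProj_transpose] at this
  rw [← Matrix.mul_assoc, Matrix.mul_sub, this]; simp

variable [Fintype n]

lemma norm_one_sub_colProj_mul_le {Y : Matrix m k ℝ} (h : (Yᵀ * Y).det ≠ 0) (A : Matrix m n ℝ)
    (C : Matrix k n ℝ) : ‖(1 - colProj Y) * A‖ ≤ ‖A - Y * C‖ := by
  have h1 := norm_sq_eq_add_of_proj (colProj_transpose Y) (colProj_mul_self h) (A - Y * C)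
  have h2 : (1 - colProj Y) * (A - Y * C) = (1 - colProj Y) * A := by
    rw [Matrix.mul_sub, ← Matrix.mul_assoc, Matrix.sub_mul _ _ Y, colProj_mul h]; simp
  rw [h2] at h1
  refine (pow_le_pow_iff_left₀ (norm_nonneg _) (norm_nonneg _) two_ne_zero).1 ?_
  nlinarith [sq_nonneg ‖colProj Y * (A - Y * C)‖]

lemma norm_one_sub_colProj_mul_le_norm {Y : Matrix m k ℝ} (h : (Yᵀ * Y).det ≠ 0)
    (A : Matrix m n ℝ) : ‖(1 - colProj Y) * A‖ ≤ ‖A‖ := by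
  simpa using norm_one_sub_colProj_mul_le h A 0

lemma norm_sq_obliqueProj_mul_sub {Psi : Matrix l m ℝ} {Y : Matrix m k ℝ}
    (h : ((Psi * Y)ᵀ * (Psi * Y)).det ≠ 0) (A : Matrix m n ℝ) :
    ‖obliqueProj Y Psi * A - A‖ ^ 2 = ‖obliqueProj Y Psi * ((1 - colProj Y) * A)‖ ^ 2 +
      ‖(1 - colProj Y) * A‖ ^ 2 := by
  have hY := det_gram_ne_zero_of_mul h
  have h1 : obliqueProj Y Psi * A - A =
      obliqueProj Y Psi * ((1 - colProj Y) * A) + -((1 - colProj Y) * A) := by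
    conv_lhs => rw [obliqueProj_mul_eq h]
    rw [Matrix.sub_mul, Matrix.one_mul]; abel
  rw [h1, norm_add_sq_of_transpose_mul_eq_zero, norm_neg]
  rw [Matrix.mul_neg, ← colProj_mul_obliqueProj_mul hY, Matrix.transpose_mul, colProj_transpose,
    Matrix.mul_assoc, ← Matrix.mul_assoc (colProj Y), Matrix.mul_sub, colProj_mul_self hY]
  simp

end Error

/-! ### Measurability of matrix operations -/

section Measurability

/-- The product `σ`-algebra on matrices; it is the Borel `σ`-algebra. -/
@[reducible] def matrixMeasurableSpace (m n : Type*) : MeasurableSpace (Matrix m n ℝ) :=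
  inferInstanceAs (MeasurableSpace (m → n → ℝ))

attribute [local instance] matrixMeasurableSpace

lemma matrix_borelSpace (m n : Type*) [Fintype m] [Fintype n] : BorelSpace (Matrix m n ℝ) :=
  inferInstanceAs (BorelSpace (m → n → ℝ))

lemma matrix_secondCountableTopology (m n : Type*) [Fintype m] [Fintype n] :
    SecondCountableTopology (Matrix m n ℝ) :=
  inferInstanceAs (SecondCountableTopology (m → n → ℝ))

attribute [local instance] matrix_borelSpace matrix_secondCountableTopology

variable {Ω : Type*} [MeasurableSpace Ω] {l m n k : Type*} [Fintype l] [Fintype m] [Fintype n]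
  [Fintype k] [DecidableEq k]

lemma measurable_matrix_mul {F : Ω → Matrix l m ℝ} {G : Ω → Matrix m n ℝ} (hF : Measurable F)
    (hG : Measurable G) : Measurable fun ω => F ω * G ω :=
  (show Continuous fun p : Matrix l m ℝ × Matrix m n ℝ => p.1 * p.2 by fun_prop).measurable.comp
    (hF.prodMk hG)

lemma measurable_matrix_transpose {F : Ω → Matrix l m ℝ} (hF : Measurable F) :
    Measurable fun ω => (F ω)ᵀ :=
  (show Continuous fun p : Matrix l m ℝ => pᵀ by fun_prop).measurable.comp hF

lemma measurable_matrix_det {F : Ω → Matrix k k ℝ} (hF : Measurable F) :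
    Measurable fun ω => (F ω).det :=
  (show Continuous fun p : Matrix k k ℝ => p.det by fun_prop).measurable.comp hF

lemma measurable_matrix_inv {F : Ω → Matrix k k ℝ} (hF : Measurable F) :
    Measurable fun ω => (F ω)⁻¹ := by
  simp only [Matrix.inv_def, Ring.inverse_eq_inv']
  have h1 : Measurable fun ω => (F ω).adjugate :=
    (show Continuous fun p : Matrix k k ℝ => p.adjugate by fun_prop).measurable.comp hF
  exact (show Continuous fun p : ℝ × Matrix k k ℝ => p.1 • p.2 by fun_prop).measurable.comp
    ((measurable_matrix_det hF).inv.prodMk h1)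

lemma measurable_leftInv {F : Ω → Matrix m k ℝ} (hF : Measurable F) :
    Measurable fun ω => leftInv (F ω) :=
  measurable_matrix_mul (measurable_matrix_inv
    (measurable_matrix_mul (measurable_matrix_transpose hF) hF)) (measurable_matrix_transpose hF)

lemma measurable_det_gram {F : Ω → Matrix m k ℝ} (hF : Measurable F) :
    Measurable fun ω => ((F ω)ᵀ * F ω).det :=
  measurable_matrix_det (measurable_matrix_mul (measurable_matrix_transpose hF) hF)

lemma measurable_colProj {F : Ω → Matrix m k ℝ} (hF : Measurable F) :
    Measurable fun ω => colProj (F ω) :=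
  measurable_matrix_mul hF (measurable_leftInv hF)

lemma measurable_obliqueProj {F : Ω → Matrix m k ℝ} {G : Ω → Matrix l m ℝ} (hF : Measurable F)
    (hG : Measurable G) : Measurable fun ω => obliqueProj (F ω) (G ω) :=
  measurable_matrix_mul (measurable_matrix_mul hF
    (measurable_leftInv (measurable_matrix_mul hG hF))) hG

lemma measurable_matrix_norm {F : Ω → Matrix l m ℝ} (hF : Measurable F) :
    Measurable fun ω => ‖F ω‖ :=
  (show Continuous fun p : Matrix l m ℝ => ‖p‖ by fun_prop).measurable.comp hF

lemma measurableSet_ambiguousSet {m n : ℕ} (r : ℕ) (X : Matrix (Fin m) (Fin n) ℝ) :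
    MeasurableSet (ambiguousSet r X) := by
  obtain ⟨K, hK, h⟩ := exists_isClosed_ambiguousSet r X
  rw [h]
  exact MeasurableSet.iUnion fun i => (hK i).measurableSet

end Measurability

/-! ### Gaussian matrices and their invariances -/

section Gaussian

attribute [local instance] matrixMeasurableSpace matrix_borelSpace matrix_secondCountableTopology

variable {l m n k m' n' : Type*} [Fintype l] [Fintype m] [Fintype n] [Fintype k] [Fintype m']
  [Fintype n']

/-- The matrix with a given family of entries. -/
def toMatrix (x : m × n → ℝ) : Matrix m n ℝ := Matrix.of fun i j => x (i, j)

lemma measurable_toMatrix {m n : Type*} :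
    Measurable (toMatrix : (m × n → ℝ) → Matrix m n ℝ) :=
  measurable_pi_iff.2 fun _ => measurable_pi_iff.2 fun _ => measurable_pi_apply _

/-- The law of a standard normal matrix. -/
noncomputable def gaussMat (m n : Type*) [Fintype m] [Fintype n] : Measure (Matrix m n ℝ) :=
  (Measure.pi fun _ : m × n => gaussianReal 0 1).map toMatrix

instance : IsProbabilityMeasure (gaussMat m n) :=
  Measure.isProbabilityMeasure_map measurable_toMatrix.aemeasurable

/-- The characteristic function of `gaussMat`, in terms of the trace inner product. -/
lemma integral_cexp_trace_gaussMat (T : Matrix m n ℝ) :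
    ∫ G, Complex.exp (((Tᵀ * G).trace : ℂ) * Complex.I) ∂gaussMat m n =
      Complex.exp (-(‖T‖ ^ 2 : ℝ) / 2) := by
  have hc : Continuous fun G : Matrix m n ℝ => Complex.exp (((Tᵀ * G).trace : ℂ) * Complex.I) := by
    fun_prop
  rw [gaussMat, integral_map measurable_toMatrix.aemeasurable
    hc.measurable.aestronglyMeasurable]
  have h1 : ∀ x : m × n → ℝ, Complex.exp (((Tᵀ * toMatrix x).trace : ℂ) * Complex.I) =
      ∏ p : m × n, Complex.exp ((T p.1 p.2 : ℂ) * x p * Complex.I) := by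
    intro x
    rw [← Complex.exp_sum, ← Finset.sum_mul]
    congr 2
    rw [Fintype.sum_prod_type, Finset.sum_comm]
    simp [Matrix.trace, Matrix.mul_apply, toMatrix]
  simp_rw [h1]
  rw [integral_fintype_prod_eq_prod (f := fun (p : m × n) (y : ℝ) =>
    Complex.exp ((T p.1 p.2 : ℂ) * y * Complex.I))]
  simp_rw [← charFun_apply_real, charFun_gaussianReal]
  rw [← Complex.exp_sum, norm_sq_eq_sum, ← Fintype.sum_prod_type']
  congr 1
  push_cast
  rw [← Finset.sum_neg_distrib, Finset.sum_div]
  exact Finset.sum_congr rfl fun p _ => by simp [neg_div]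

lemma exists_trace_eq (L : Matrix m n ℝ →L[ℝ] ℝ) :
    ∃ T : Matrix m n ℝ, ∀ G, L G = (Tᵀ * G).trace := by
  classical
  refine ⟨Matrix.of fun i j => L (Matrix.single i j 1), fun G => ?_⟩
  conv_lhs => rw [Matrix.matrix_eq_sum_single G]
  simp only [map_sum, Matrix.trace, Matrix.mul_apply, Matrix.diag_apply, Matrix.transpose_apply,
    Matrix.of_apply]
  rw [Finset.sum_comm]
  refine Finset.sum_congr rfl fun j _ => Finset.sum_congr rfl fun i _ => ?_
  rw [show Matrix.single i j (G i j) = G i j • Matrix.single i j (1 : ℝ) by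
    rw [Matrix.smul_single]; simp, map_smul, smul_eq_mul, mul_comm]

/-- A probability measure with the characteristic function of `gaussMat` is `gaussMat`. -/
lemma eq_gaussMat {ν : Measure (Matrix m n ℝ)} [IsProbabilityMeasure ν]
    (h : ∀ T : Matrix m n ℝ, ∫ G, Complex.exp (((Tᵀ * G).trace : ℂ) * Complex.I) ∂ν =
      Complex.exp (-(‖T‖ ^ 2 : ℝ) / 2)) : ν = gaussMat m n := by
  have : @BorelSpace (Matrix m n ℝ) PseudoMetricSpace.toUniformSpace.toTopologicalSpace
    (matrixMeasurableSpace m n) := matrix_borelSpace m n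
  have : @SecondCountableTopology (Matrix m n ℝ)
    PseudoMetricSpace.toUniformSpace.toTopologicalSpace := matrix_secondCountableTopology m n
  apply Measure.ext_of_charFunDual
  ext L
  obtain ⟨T, hT⟩ := exists_trace_eq L
  have key : ∀ ρ : Measure (Matrix m n ℝ), charFunDual ρ L =
      ∫ G, Complex.exp (((Tᵀ * G).trace : ℂ) * Complex.I) ∂ρ := fun ρ =>
    integral_congr_ae (ae_of_all _ fun G =>
      congrArg (fun z : ℝ => Complex.exp (z * Complex.I)) (hT G))
  rw [key, key, h, integral_cexp_trace_gaussMat]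

/-- Rotation invariance: a linear image of a standard normal matrix is standard normal if the
adjoint map (with respect to the trace inner product) is isometric. -/
lemma map_gaussMat {F : Matrix m n ℝ → Matrix m' n' ℝ} (hF : Measurable F)
    (T' : Matrix m' n' ℝ → Matrix m n ℝ)
    (hT : ∀ T G, (Tᵀ * F G).trace = ((T' T)ᵀ * G).trace) (hn : ∀ T, ‖T' T‖ ^ 2 = ‖T‖ ^ 2) :
    (gaussMat m n).map F = gaussMat m' n' := by
  have := Measure.isProbabilityMeasure_map (μ := gaussMat m n) hF.aemeasurable
  refine eq_gaussMat fun T => ?_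
  have hc : Continuous fun G : Matrix m' n' ℝ =>
      Complex.exp (((Tᵀ * G).trace : ℂ) * Complex.I) := by fun_prop
  rw [integral_map hF.aemeasurable hc.measurable.aestronglyMeasurable]
  simp_rw [hT]
  rw [integral_cexp_trace_gaussMat, hn]

/-- Rotation invariance of a pair of independent standard normal matrices. -/
lemma map_gaussMat_prod {F : Matrix l k ℝ → Matrix m' n' ℝ} {F' : Matrix m n ℝ → Matrix m' n' ℝ}
    (hF : Measurable F) (hF' : Measurable F')
    (T₁ : Matrix m' n' ℝ → Matrix l k ℝ) (T₂ : Matrix m' n' ℝ → Matrix m n ℝ)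
    (hT₁ : ∀ T G, (Tᵀ * F G).trace = ((T₁ T)ᵀ * G).trace)
    (hT₂ : ∀ T G, (Tᵀ * F' G).trace = ((T₂ T)ᵀ * G).trace)
    (hn : ∀ T, ‖T₁ T‖ ^ 2 + ‖T₂ T‖ ^ 2 = ‖T‖ ^ 2) :
    ((gaussMat l k).prod (gaussMat m n)).map (fun p => F p.1 + F' p.2) = gaussMat m' n' := by
  have hm : Measurable fun p : Matrix l k ℝ × Matrix m n ℝ => F p.1 + F' p.2 :=
    (show Continuous fun q : Matrix m' n' ℝ × Matrix m' n' ℝ => q.1 + q.2 by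
      fun_prop).measurable.comp ((hF.comp measurable_fst).prodMk (hF'.comp measurable_snd))
  have := Measure.isProbabilityMeasure_map (μ := (gaussMat l k).prod (gaussMat m n))
    hm.aemeasurable
  refine eq_gaussMat fun T => ?_
  have hc : Continuous fun G : Matrix m' n' ℝ =>
      Complex.exp (((Tᵀ * G).trace : ℂ) * Complex.I) := by fun_prop
  rw [integral_map hm.aemeasurable hc.measurable.aestronglyMeasurable]
  simp_rw [Matrix.mul_add, Matrix.trace_add, hT₁, hT₂, Complex.ofReal_add, add_mul, Complex.exp_add]
  rw [integral_prod_mul (μ := gaussMat l k) (ν := gaussMat m n)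
    (fun G => Complex.exp ((((T₁ T)ᵀ * G).trace : ℂ) * Complex.I))
    (fun G => Complex.exp ((((T₂ T)ᵀ * G).trace : ℂ) * Complex.I)),
    integral_cexp_trace_gaussMat, integral_cexp_trace_gaussMat, ← Complex.exp_add, ← hn T]
  congr 1; push_cast; ring

lemma map_mul_gaussMat [DecidableEq k] {V : Matrix n k ℝ} (hV : Vᵀ * V = 1) :
    (gaussMat m n).map (fun G => G * V) = gaussMat m k := by
  refine map_gaussMat (measurable_matrix_mul measurable_id measurable_const) (fun T => T * Vᵀ)
    (fun T G => ?_) (fun T => ?_)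
  · rw [← Matrix.mul_assoc, Matrix.trace_mul_comm, Matrix.transpose_mul,
      Matrix.transpose_transpose, Matrix.mul_assoc]
  · rw [norm_mul_transpose_of_transpose_mul_self hV]

lemma map_transpose_gaussMat : (gaussMat m n).map (fun G => Gᵀ) = gaussMat n m := by
  refine map_gaussMat (measurable_matrix_transpose measurable_id) (fun T => Tᵀ)
    (fun T G => ?_) (fun T => by rw [Matrix.frobenius_norm_transpose])
  rw [← Matrix.trace_transpose, Matrix.transpose_mul, Matrix.trace_mul_comm]
  simp

lemma map_transpose_mul_gaussMat [DecidableEq k] {E : Matrix m k ℝ} (hE : Eᵀ * E = 1) :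
    (gaussMat m n).map (fun G => Eᵀ * G) = gaussMat k n := by
  refine map_gaussMat (measurable_matrix_mul measurable_const measurable_id) (fun T => E * T)
    (fun T G => ?_) (fun T => by rw [norm_mul_of_transpose_mul_self hE])
  rw [Matrix.transpose_mul, Matrix.mul_assoc]

/-- Resampling a standard normal matrix along the kernel of an orthogonal projection `P` of the row
space. Hence `G P` and `G (1 - P)` are independent. -/
lemma map_resample_gaussMat [DecidableEq n] {P : Matrix n n ℝ} (hs : Pᵀ = P) (hi : P * P = P) :
    ((gaussMat m n).prod (gaussMat m n)).map (fun p => p.1 * P + p.2 * (1 - P)) =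
      gaussMat m n := by
  have key : ∀ (P' : Matrix n n ℝ), P'ᵀ = P' → ∀ T G : Matrix m n ℝ,
      (Tᵀ * (G * P')).trace = ((T * P')ᵀ * G).trace := fun P' h T G => by
    rw [← Matrix.mul_assoc, Matrix.trace_mul_comm, Matrix.transpose_mul, h, Matrix.mul_assoc]
  refine map_gaussMat_prod (measurable_matrix_mul measurable_id measurable_const)
    (measurable_matrix_mul measurable_id measurable_const)
    (fun T => T * P) (fun T => T * (1 - P)) (key P hs) (key _ (by simp [hs])) (fun T => ?_)
  rw [← Matrix.frobenius_norm_transpose (T * P), ← Matrix.frobenius_norm_transpose (T * (1 - P)),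
    ← Matrix.frobenius_norm_transpose T, norm_sq_eq_add_of_proj hs hi Tᵀ]
  simp [hs]

/-- Resampling the `i`-th column of a standard normal matrix. -/
lemma map_resample_col_gaussMat [DecidableEq n] (i : n) :
    ((gaussMat m n).prod (gaussMat m (Fin 1))).map (fun p => p.1.updateCol i (p.2.col 0)) =
      gaussMat m n := by
  have h1 : ∀ p : Matrix m n ℝ × Matrix m (Fin 1) ℝ, p.1.updateCol i (p.2.col 0) =
      p.1.updateCol i 0 + (0 : Matrix m n ℝ).updateCol i (p.2.col 0) := by
    intro p; ext a b
    by_cases h : b = i <;> simp [h]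
  simp_rw [h1]
  refine map_gaussMat_prod (F := fun G : Matrix m n ℝ => G.updateCol i 0)
    (F' := fun g : Matrix m (Fin 1) ℝ => (0 : Matrix m n ℝ).updateCol i (g.col 0)) ?_ ?_
    (fun T => T.updateCol i 0) (fun T => Matrix.of fun a _ => T a i) ?_ ?_ ?_
  · exact Continuous.measurable (by fun_prop)
  · refine Continuous.measurable (Continuous.matrix_updateCol i continuous_const ?_)
    exact continuous_pi fun a => continuous_id.matrix_elem a 0
  · intro T G
    simp only [Matrix.trace, Matrix.mul_apply, Matrix.diag_apply, Matrix.transpose_apply,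
      Matrix.updateCol_apply]
    refine Finset.sum_congr rfl fun b _ => Finset.sum_congr rfl fun a _ => ?_
    split_ifs <;> simp
  · intro T G
    simp [Matrix.trace, Matrix.mul_apply, Matrix.updateCol_apply]
  · intro T
    simp only [norm_sq_eq_sum, ← Finset.sum_add_distrib, Matrix.updateCol_apply]
    refine Finset.sum_congr rfl fun a _ => ?_
    rw [← Finset.add_sum_erase _ (fun j => T a j ^ 2) (Finset.mem_univ i),
      ← Finset.add_sum_erase _ _ (Finset.mem_univ i)]
    rw [Finset.sum_congr rfl (g := fun j => T a j ^ 2) fun j hj => by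
      rw [if_neg (Finset.ne_of_mem_erase hj)]]
    simp [add_comm]

end Gaussian

/-! ### Moments of Gaussian matrices -/

section Moments

attribute [local instance] matrixMeasurableSpace matrix_borelSpace matrix_secondCountableTopology

variable {l m n k : Type*} [Fintype l] [Fintype m] [Fintype n] [Fintype k]

lemma lintegral_trace_sq_gaussMat (T : Matrix m n ℝ) :
    ∫⁻ G, ENNReal.ofReal ((Tᵀ * G).trace ^ 2) ∂gaussMat m n = ENNReal.ofReal (‖T‖ ^ 2) := by
  have hm : Measurable fun G : Matrix m n ℝ => ENNReal.ofReal ((Tᵀ * G).trace ^ 2) :=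
    (Continuous.measurable (by fun_prop)).ennreal_ofReal
  rw [gaussMat, lintegral_map hm measurable_toMatrix]
  let X : m × n → ℝ → ℝ := fun p y => T p.1 p.2 * y
  have hX : ∀ p, MemLp (X p) 2 (gaussianReal 0 1) := fun p =>
    (memLp_id_gaussianReal 2).const_mul _
  let S : (m × n → ℝ) → ℝ := ∑ p, fun x : m × n → ℝ => X p (x p)
  have h1 : ∀ x : m × n → ℝ, (Tᵀ * toMatrix x).trace = S x := by
    intro x
    simp only [S, X, Finset.sum_apply]
    rw [Fintype.sum_prod_type, Finset.sum_comm]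
    simp [Matrix.trace, Matrix.mul_apply, toMatrix]
  simp_rw [h1]
  have hmem : ∀ p, MemLp (fun x : m × n → ℝ => X p (x p)) 2
      (Measure.pi fun _ : m × n => gaussianReal 0 1) := fun p =>
    (hX p).comp_measurePreserving (measurePreserving_eval (fun _ : m × n => gaussianReal 0 1) p)
  have hS : MemLp S 2 (Measure.pi fun _ : m × n => gaussianReal 0 1) :=
    memLp_finsetSum' _ fun p _ => hmem p
  have hmean : ∫ x, S x ∂(Measure.pi fun _ : m × n => gaussianReal 0 1) = 0 := by
    simp only [S, Finset.sum_apply]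
    rw [integral_finsetSum _ fun p _ => (hmem p).integrable one_le_two]
    refine Finset.sum_eq_zero fun p _ => ?_
    simp [X, integral_const_mul, integral_eval]
  have hvar := variance_sum_pi hX
  rw [variance_of_integral_eq_zero hS.aemeasurable hmean] at hvar
  rw [← ofReal_integral_eq_lintegral_ofReal hS.integrable_sq (ae_of_all _ fun _ => sq_nonneg _)]
  congr 1
  refine hvar.trans ?_
  rw [norm_sq_eq_sum, ← Fintype.sum_prod_type']
  refine Finset.sum_congr rfl fun p _ => ?_
  simp only [X]
  rw [variance_const_mul]
  have : Var[fun y : ℝ => y; gaussianReal 0 1] = 1 := variance_id_gaussianReal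
  rw [this, mul_one]

lemma lintegral_norm_sq_mul_gaussMat (K : Matrix l m ℝ) (Z : Matrix n k ℝ) :
    ∫⁻ G, ENNReal.ofReal (‖K * G * Z‖ ^ 2) ∂gaussMat m n = ENNReal.ofReal (‖K‖ ^ 2 * ‖Z‖ ^ 2) := by
  let T : l → k → Matrix m n ℝ := fun a b => Matrix.of fun i j => K a i * Z j b
  have h1 : ∀ (G : Matrix m n ℝ) a b, (K * G * Z) a b = ((T a b)ᵀ * G).trace := by
    intro G a b
    simp only [Matrix.mul_apply, Matrix.trace, Matrix.diag_apply, T, Matrix.transpose_apply,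
      Matrix.of_apply, Finset.sum_mul]
    exact Finset.sum_congr rfl fun _ _ => Finset.sum_congr rfl fun _ _ => by ring
  have hm : ∀ a b, Measurable fun G : Matrix m n ℝ =>
      ENNReal.ofReal (((T a b)ᵀ * G).trace ^ 2) := fun a b =>
    (Continuous.measurable (by fun_prop)).ennreal_ofReal
  have h2 : ∀ G : Matrix m n ℝ, ENNReal.ofReal (‖K * G * Z‖ ^ 2) =
      ∑ a, ∑ b, ENNReal.ofReal (((T a b)ᵀ * G).trace ^ 2) := by
    intro G
    rw [norm_sq_eq_sum, ENNReal.ofReal_sum_of_nonneg fun _ _ => by positivity]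
    refine Finset.sum_congr rfl fun a _ => ?_
    rw [ENNReal.ofReal_sum_of_nonneg fun _ _ => by positivity]
    exact Finset.sum_congr rfl fun b _ => by rw [h1]
  simp_rw [h2]
  rw [lintegral_finsetSum _ fun a _ => Finset.measurable_sum _ fun b _ => hm a b]
  simp_rw [lintegral_finsetSum _ fun b _ => hm _ b, lintegral_trace_sq_gaussMat]
  rw [Finset.sum_congr rfl fun a _ => (ENNReal.ofReal_sum_of_nonneg fun b _ => by positivity).symm,
    ← ENNReal.ofReal_sum_of_nonneg fun a _ => by positivity]
  congr 1
  simp_rw [norm_sq_eq_sum, T, Matrix.of_apply, mul_pow, ← Finset.mul_sum]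
  rw [Finset.sum_mul]
  refine Finset.sum_congr rfl fun a _ => ?_
  simp_rw [← Finset.sum_mul]
  rw [← Finset.mul_sum, Finset.sum_comm]

/-- The Laplace transform of the square of a standard normal variable. -/
lemma lintegral_exp_neg_sq_gaussianReal {t : ℝ} (ht : 0 ≤ t) :
    ∫⁻ x, ENNReal.ofReal (Real.exp (-(t * x ^ 2))) ∂gaussianReal 0 1 =
      ENNReal.ofReal ((1 + 2 * t) ^ (-(1 / 2) : ℝ)) := by
  have hb : 0 < t + 1 / 2 := by positivity
  have hpi : 0 < 2 * Real.pi := by positivity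
  have hint : Integrable (fun x : ℝ => Real.exp (-(t * x ^ 2))) (gaussianReal 0 1) := by
    refine Integrable.of_bound (C := 1) (by fun_prop) (ae_of_all _ fun x => ?_)
    rw [Real.norm_eq_abs, abs_of_pos (Real.exp_pos _), Real.exp_le_one_iff]
    have : 0 ≤ t * x ^ 2 := by positivity
    linarith
  rw [← ofReal_integral_eq_lintegral_ofReal hint (ae_of_all _ fun _ => (Real.exp_pos _).le)]
  congr 1
  rw [integral_gaussianReal_eq_integral_smul one_ne_zero]
  have h1 : ∀ x : ℝ, gaussianPDFReal 0 1 x • Real.exp (-(t * x ^ 2)) =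
      (√(2 * Real.pi))⁻¹ * Real.exp (-(t + 1 / 2) * x ^ 2) := by
    intro x
    rw [gaussianPDFReal, smul_eq_mul, mul_assoc, ← Real.exp_add]
    congr 2
    · simp
    · simp; ring
  simp_rw [h1]
  rw [integral_const_mul, integral_gaussian, Real.rpow_neg (by positivity), ← Real.sqrt_eq_rpow,
    ← Real.sqrt_inv, ← Real.sqrt_mul (by positivity), ← Real.sqrt_inv]
  congr 1
  field_simp
  ring

/-- The inverse of a nonnegative number as a Laplace integral; both sides are `∞` for `s = 0`. -/
lemma inv_ofReal_eq_lintegral {s : ℝ} (hs : 0 ≤ s) :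
    (ENNReal.ofReal s)⁻¹ = ∫⁻ t in Set.Ioi (0 : ℝ), ENNReal.ofReal (Real.exp (-(t * s))) := by
  rcases hs.eq_or_lt with rfl | hs
  · simp
  · have hint : IntegrableOn (fun t : ℝ => Real.exp (-(t * s))) (Set.Ioi 0) := by
      simpa [mul_comm] using exp_neg_integrableOn_Ioi 0 hs
    rw [← ofReal_integral_eq_lintegral_ofReal hint (ae_of_all _ fun _ => (Real.exp_pos _).le),
      ← ENNReal.ofReal_inv_of_pos hs]
    congr 1
    have := integral_exp_mul_Ioi (a := -s) (by linarith) 0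
    simp only [mul_zero, Real.exp_zero] at this
    rw [show (fun t : ℝ => Real.exp (-(t * s))) = fun t => Real.exp (-s * t) by
      ext t; congr 1; ring, this]
    field_simp

lemma lintegral_Ioi_rpow {p : ℝ} (hp : 1 < p) :
    ∫⁻ t in Set.Ioi (0 : ℝ), ENNReal.ofReal ((1 + 2 * t) ^ (-p)) =
      ENNReal.ofReal (1 / (2 * (p - 1))) := by
  have hd : ∀ t ∈ Set.Ici (0 : ℝ), HasDerivAt (fun t : ℝ => -(1 + 2 * t) ^ (1 - p) / (2 * (p - 1)))
      ((1 + 2 * t) ^ (-p)) t := by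
    intro t ht
    have hpos : 0 < 1 + 2 * t := by have : 0 ≤ t := ht; positivity
    have h1 : HasDerivAt (fun t : ℝ => 1 + 2 * t) 2 t := by
      simpa using ((hasDerivAt_id t).const_mul 2).const_add 1
    have h2 := ((h1.rpow_const (p := 1 - p) (Or.inl hpos.ne')).neg).div_const (2 * (p - 1))
    convert! h2 using 1
    have : p - 1 ≠ 0 := by linarith
    rw [show 1 - p - 1 = -p by ring]
    field_simp
    ring
  have hlim : Tendsto (fun t : ℝ => -(1 + 2 * t) ^ (1 - p) / (2 * (p - 1))) atTop (𝓝 0) := by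
    have h1 : Tendsto (fun t : ℝ => 1 + 2 * t) atTop atTop :=
      tendsto_atTop_add_const_left _ _ (tendsto_id.const_mul_atTop two_pos)
    have h2 := (tendsto_rpow_neg_atTop (y := p - 1) (by linarith)).comp h1
    have h3 := (h2.neg).div_const (2 * (p - 1))
    simpa [Function.comp_def] using h3
  have hnn : ∀ t ∈ Set.Ioi (0 : ℝ), 0 ≤ (1 + 2 * t) ^ (-p) := fun t ht => by
    have : 0 < t := ht
    positivity
  have hint := integrableOn_Ioi_deriv_of_nonneg' hd hnn hlim
  rw [← ofReal_integral_eq_lintegral_ofReal hint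
    ((ae_restrict_iff' measurableSet_Ioi).2 (ae_of_all _ hnn)),
    integral_Ioi_of_hasDerivAt_of_nonneg' hd hnn hlim]
  congr 1
  have : p - 1 ≠ 0 := by linarith
  simp
  field_simp

/-- The first inverse moment of a chi-squared variable with at least three degrees of freedom. -/
lemma lintegral_inv_norm_sq_gaussMat {v : ℕ} (hv : 3 ≤ v) :
    ∫⁻ g, (ENNReal.ofReal (‖g‖ ^ 2))⁻¹ ∂gaussMat (Fin v) (Fin 1) =
      ENNReal.ofReal (1 / ((v : ℝ) - 2)) := by
  have hm : Measurable fun G : Matrix (Fin v) (Fin 1) ℝ => (ENNReal.ofReal (‖G‖ ^ 2))⁻¹ :=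
    ((measurable_matrix_norm measurable_id).pow_const 2).ennreal_ofReal.inv
  rw [gaussMat, lintegral_map hm measurable_toMatrix]
  let ι := Fin v × Fin 1
  let γ : Measure (ι → ℝ) := Measure.pi fun _ : ι => gaussianReal 0 1
  have h1 : ∀ x : ι → ℝ, (ENNReal.ofReal (‖toMatrix x‖ ^ 2))⁻¹ =
      ∫⁻ t in Set.Ioi (0 : ℝ), ∏ p, ENNReal.ofReal (Real.exp (-(t * x p ^ 2))) := by
    intro x
    rw [inv_ofReal_eq_lintegral (by positivity)]
    refine lintegral_congr fun t => ?_
    rw [← ENNReal.ofReal_prod_of_nonneg fun _ _ => (Real.exp_pos _).le, ← Real.exp_sum,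
      Finset.sum_neg_distrib, ← Finset.mul_sum, norm_sq_eq_sum, Fintype.sum_prod_type]
    rfl
  simp_rw [h1]
  have hmeas : Measurable (Function.uncurry fun (x : ι → ℝ) (t : ℝ) =>
      ∏ p, ENNReal.ofReal (Real.exp (-(t * x p ^ 2)))) := by
    refine Finset.measurable_prod _ fun p _ => ?_
    exact (Continuous.measurable (by fun_prop)).ennreal_ofReal
  rw [lintegral_lintegral_swap (μ := γ) hmeas.aemeasurable]
  have h2 : ∀ t ∈ Set.Ioi (0 : ℝ), ∫⁻ x : ι → ℝ,
      ∏ p, ENNReal.ofReal (Real.exp (-(t * x p ^ 2))) ∂γ =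
      ENNReal.ofReal ((1 + 2 * t) ^ (-((v : ℝ) / 2))) := by
    intro t ht
    have ht0 : 0 < t := ht
    have hind : iIndepFun (fun (p : ι) (x : ι → ℝ) =>
        ENNReal.ofReal (Real.exp (-(t * x p ^ 2)))) γ :=
      iIndepFun_pi (μ := fun _ : ι => gaussianReal 0 1)
        (X := fun _ y => ENNReal.ofReal (Real.exp (-(t * y ^ 2))))
        fun p => (Continuous.measurable (by fun_prop)).ennreal_ofReal.aemeasurable
    have hmp : ∀ p : ι, Measurable fun x : ι → ℝ =>
        ENNReal.ofReal (Real.exp (-(t * x p ^ 2))) := fun p =>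
      (Continuous.measurable (by fun_prop)).ennreal_ofReal
    rw [lintegral_prod_eq_prod_lintegral_of_indepFun Finset.univ _ hind hmp]
    have h3 : ∀ p : ι, ∫⁻ x : ι → ℝ, ENNReal.ofReal (Real.exp (-(t * x p ^ 2))) ∂γ =
        ENNReal.ofReal ((1 + 2 * t) ^ (-(1 / 2) : ℝ)) := by
      intro p
      rw [← lintegral_exp_neg_sq_gaussianReal ht0.le,
        ← (measurePreserving_eval (fun _ : ι => gaussianReal 0 1) p).lintegral_comp
          (f := fun y => ENNReal.ofReal (Real.exp (-(t * y ^ 2))))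
          (Continuous.measurable (by fun_prop)).ennreal_ofReal]
    simp_rw [h3]
    rw [Finset.prod_const, ← ENNReal.ofReal_pow (by positivity), ← Real.rpow_natCast,
      ← Real.rpow_mul (by positivity)]
    congr 2
    simp [ι]
    ring
  rw [setLIntegral_congr_fun measurableSet_Ioi h2, lintegral_Ioi_rpow]
  · congr 2; ring
  · have : (3 : ℝ) ≤ v := by exact_mod_cast hv
    linarith

end Moments

/-! ### The pseudoinverse of a Gaussian matrix -/

section Pseudoinverse

attribute [local instance] matrixMeasurableSpace matrix_borelSpace matrix_secondCountableTopology

lemma matrix_rank_add_le {m n : Type*} [Fintype m] [Fintype n] (A B : Matrix m n ℝ) :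
    (A + B).rank ≤ A.rank + B.rank := by
  have h : ∀ C : Matrix m n ℝ, C.mulVecLin.rank = (C.rank : Cardinal) := fun C =>
    (Module.finrank_eq_rank ℝ C.mulVecLin.range).symm
  have := LinearMap.rank_add_le A.mulVecLin B.mulVecLin
  rw [← Matrix.mulVecLin_add, h, h, h] at this
  exact_mod_cast this

/-- The orthogonal complement of the columns of `G` other than the `i`-th one has an orthonormal
basis, given by the columns of `E`, of at least `p - j + 1` vectors. -/
lemma exists_orthonormal_compl_cols {p j : ℕ} (G : Matrix (Fin p) (Fin j) ℝ) (i : Fin j) :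
    ∃ (v : ℕ) (E : Matrix (Fin p) (Fin v) ℝ), Eᵀ * E = 1 ∧ p + 1 ≤ v + j ∧
      Eᵀ * G.updateCol i 0 = 0 := by
  set G₀ := G.updateCol i 0 with hG₀
  obtain ⟨V, hV, hVG, -⟩ := exists_orthonormal_range G₀
  have hrank : G₀.rank + 1 ≤ j := by
    have h1 : G₀ = G * Matrix.diagonal (fun a => if a = i then (0 : ℝ) else 1) := by
      ext a b
      rw [Matrix.mul_diagonal, hG₀, Matrix.updateCol_apply]
      split_ifs <;> simp
    have h2 : (Matrix.diagonal (fun a : Fin j => if a = i then (0 : ℝ) else 1)).rank = j - 1 := by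
      rw [Matrix.rank_diagonal, Fintype.card_subtype]
      have : (Finset.univ.filter fun a : Fin j => (if a = i then (0 : ℝ) else 1) ≠ 0) =
          Finset.univ.erase i := by
        ext a; simp
      rw [this, Finset.card_erase_of_mem (Finset.mem_univ i), Finset.card_univ, Fintype.card_fin]
    have h3 := Matrix.rank_mul_le_right G (Matrix.diagonal (fun a => if a = i then (0 : ℝ) else 1))
    rw [← h1, h2] at h3
    have := i.pos
    omega
  obtain ⟨E, hE, -, S, hS⟩ := exists_orthonormal_range (1 - V * Vᵀ)
  refine ⟨_, E, hE, ?_, ?_⟩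
  · have h1 : p ≤ (1 - V * Vᵀ).rank + (V * Vᵀ).rank := by
      have := matrix_rank_add_le (1 - V * Vᵀ) (V * Vᵀ)
      rwa [sub_add_cancel, Matrix.rank_one, Fintype.card_fin] at this
    have h2 : (V * Vᵀ).rank ≤ G₀.rank :=
      (Matrix.rank_mul_le_left _ _).trans (Matrix.rank_le_width V)
    omega
  · rw [hS, Matrix.transpose_mul, Matrix.mul_assoc]
    have : (1 - V * Vᵀ)ᵀ * G₀ = 0 := by
      simp only [Matrix.transpose_sub, Matrix.transpose_one, Matrix.transpose_mul,
        Matrix.transpose_transpose, Matrix.sub_mul, Matrix.one_mul, Matrix.mul_assoc, hVG, sub_self]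
    rw [this, Matrix.mul_zero]

/-- The `i`-th row of `leftInv H` is the shortest vector `w` with `⟨w, h_a⟩ = δ_{ia}` for all
columns `h_a` of `H`. -/
lemma sum_sq_leftInv_le {p j : ℕ} {H : Matrix (Fin p) (Fin j) ℝ} (hH : (Hᵀ * H).det ≠ 0)
    (i : Fin j) {w : Matrix (Fin p) (Fin 1) ℝ} (hw : wᵀ * H = Matrix.single 0 i 1) :
    ∑ b, leftInv H i b ^ 2 ≤ ‖w‖ ^ 2 := by
  have h1 : ‖Matrix.single (0 : Fin 1) i (1 : ℝ) * leftInv H‖ ^ 2 = ∑ b, leftInv H i b ^ 2 := by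
    rw [norm_sq_eq_sum]; simp
  rw [← h1, ← hw, Matrix.mul_assoc, ← colProj, ← colProj_transpose, ← Matrix.transpose_mul,
    Matrix.frobenius_norm_transpose]
  rw [norm_sq_eq_add_of_proj (colProj_transpose H) (colProj_mul_self hH) w]
  nlinarith [sq_nonneg ‖(1 - colProj H) * w‖]

/-- The second moment of the `i`-th row of the pseudoinverse of a Gaussian matrix. Conditionally on
the other columns, the squared norm of the row is at most the inverse of a chi-squared variable with
at least `p - j + 1` degrees of freedom, namely of the squared distance of the `i`-th column to the
span of the others. -/
lemma lintegral_sum_sq_leftInv_le {p j : ℕ} (hpj : 2 * j + 1 ≤ p) (i : Fin j) :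
    ∫⁻ H, ENNReal.ofReal (∑ b, leftInv H i b ^ 2) ∂gaussMat (Fin p) (Fin j) ≤
      ENNReal.ofReal (1 / (j : ℝ)) := by
  have hj : 0 < j := i.pos
  have hm : Measurable fun H : Matrix (Fin p) (Fin j) ℝ =>
      ENNReal.ofReal (∑ b, leftInv H i b ^ 2) := by
    refine (Finset.measurable_sum _ fun b _ => ?_).ennreal_ofReal
    exact ((measurable_pi_apply b).comp ((measurable_pi_apply i).comp
      (measurable_leftInv measurable_id))).pow_const 2
  have hF : Measurable fun q : Matrix (Fin p) (Fin j) ℝ × Matrix (Fin p) (Fin 1) ℝ =>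
      q.1.updateCol i (q.2.col 0) := by
    refine (Continuous.matrix_updateCol i continuous_fst ?_).measurable
    exact continuous_pi fun a => continuous_snd.matrix_elem a 0
  rw [← map_resample_col_gaussMat i, lintegral_map hm hF]
  refine (lintegral_prod _ (hm.comp hF).aemeasurable).trans_le ?_
  refine (lintegral_mono fun G => ?_).trans_eq (by rw [lintegral_const, measure_univ, mul_one])
  obtain ⟨v, E, hE, hv, hEG⟩ := exists_orthonormal_compl_cols G i
  have hmv : Measurable fun g : Matrix (Fin v) (Fin 1) ℝ => (ENNReal.ofReal (‖g‖ ^ 2))⁻¹ :=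
    ((measurable_matrix_norm measurable_id).pow_const 2).ennreal_ofReal.inv
  calc ∫⁻ g, ENNReal.ofReal (∑ b, leftInv (G.updateCol i (g.col 0)) i b ^ 2)
        ∂gaussMat (Fin p) (Fin 1)
      ≤ ∫⁻ g, (ENNReal.ofReal (‖Eᵀ * g‖ ^ 2))⁻¹ ∂gaussMat (Fin p) (Fin 1) := by
        refine lintegral_mono fun g => ?_
        set H := G.updateCol i (g.col 0) with hHdef
        by_cases hH : (Hᵀ * H).det = 0
        -- For a singular Gram matrix, both the inverse and `leftInv H` are zero.
        · have : leftInv H = 0 := by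
            rw [leftInv, Matrix.nonsing_inv_apply_not_isUnit _ (by simp [hH]), Matrix.zero_mul]
          simp [this]
        rcases (sq_nonneg ‖Eᵀ * g‖).eq_or_lt with h0 | h0
        -- If `Eᵀ g = 0`, the right-hand side is `0⁻¹ = ∞`.
        · simp [← h0]
        rw [← ENNReal.ofReal_inv_of_pos h0]
        refine ENNReal.ofReal_le_ofReal ?_
        -- The component of `g` orthogonal to the other columns, scaled such that `⟨w, g⟩ = 1`.
        let w : Matrix (Fin p) (Fin 1) ℝ := (‖Eᵀ * g‖ ^ 2)⁻¹ • (E * (Eᵀ * g))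
        have hEH : Eᵀ * H = (0 : Matrix (Fin v) (Fin j) ℝ).updateCol i ((Eᵀ * g).col 0) := by
          ext a b
          by_cases hb : b = i
          · subst hb; simp [hHdef, Matrix.mul_apply]
          · have := congrFun (congrFun hEG a) b
            simpa [hHdef, Matrix.mul_apply, Matrix.updateCol_apply, hb] using this
        have hw : wᵀ * H = Matrix.single 0 i 1 := by
          ext a b
          fin_cases a
          simp only [w, Matrix.transpose_smul, Matrix.transpose_mul E, Matrix.smul_mul,
            Matrix.mul_assoc, hEH]
          by_cases hb : b = i
          · subst hb
            have h2 : ‖Eᵀ * g‖ ^ 2 = ∑ a, (Eᵀ * g) a 0 * (Eᵀ * g) a 0 := by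
              rw [norm_sq_eq_sum]; simp [sq]
            have h3 : ((Eᵀ * g)ᵀ *
                (0 : Matrix (Fin v) (Fin j) ℝ).updateCol b ((Eᵀ * g).col 0)) 0 b =
                ‖Eᵀ * g‖ ^ 2 := by
              rw [h2, Matrix.mul_apply]; simp
            rw [Matrix.smul_apply, Fin.zero_eta, h3, smul_eq_mul, inv_mul_cancel₀ h0.ne']; simp
          · simp [Matrix.mul_apply, hb, Ne.symm hb]
        have hnw : ‖w‖ ^ 2 = (‖Eᵀ * g‖ ^ 2)⁻¹ := by
          simp only [w, norm_smul, norm_mul_of_transpose_mul_self hE, norm_inv, norm_pow, norm_norm]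
          have : ‖Eᵀ * g‖ ≠ 0 := fun h => by simp [h] at h0
          field_simp
        exact hnw ▸ sum_sq_leftInv_le hH i hw
    _ = ∫⁻ g, (ENNReal.ofReal (‖g‖ ^ 2))⁻¹ ∂gaussMat (Fin v) (Fin 1) := by
        have hmE : Measurable fun g : Matrix (Fin p) (Fin 1) ℝ => Eᵀ * g :=
          measurable_matrix_mul measurable_const measurable_id
        rw [← map_transpose_mul_gaussMat hE, lintegral_map hmv hmE]
    _ = ENNReal.ofReal (1 / ((v : ℝ) - 2)) := lintegral_inv_norm_sq_gaussMat (by omega)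
    _ ≤ ENNReal.ofReal (1 / (j : ℝ)) := by
        refine ENNReal.ofReal_le_ofReal (one_div_le_one_div_of_le (by exact_mod_cast hj) ?_)
        have : j + 2 ≤ v := by omega
        have : ((j + 2 : ℕ) : ℝ) ≤ v := by exact_mod_cast this
        push_cast at this; linarith

/-- A tall standard normal matrix `H`, with more than twice as many rows as columns, has a left
inverse with `𝔼 ‖H†‖² ≤ 1`. -/
lemma lintegral_norm_sq_leftInv_le {p j : ℕ} (hpj : 2 * j + 1 ≤ p) :
    ∫⁻ H, ENNReal.ofReal (‖leftInv H‖ ^ 2) ∂gaussMat (Fin p) (Fin j) ≤ 1 := by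
  have hm : ∀ i, Measurable fun H : Matrix (Fin p) (Fin j) ℝ =>
      ENNReal.ofReal (∑ b, leftInv H i b ^ 2) := fun i => by
    refine (Finset.measurable_sum _ fun b _ => ?_).ennreal_ofReal
    exact ((measurable_pi_apply b).comp ((measurable_pi_apply i).comp
      (measurable_leftInv measurable_id))).pow_const 2
  simp_rw [norm_sq_eq_sum]
  rw [lintegral_congr fun H => ENNReal.ofReal_sum_of_nonneg fun _ _ => by positivity,
    lintegral_finsetSum _ fun i _ => hm i]
  refine (Finset.sum_le_sum fun i _ => lintegral_sum_sq_leftInv_le hpj i).trans ?_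
  rw [← ENNReal.ofReal_sum_of_nonneg fun _ _ => by positivity, ← ENNReal.ofReal_one]
  refine ENNReal.ofReal_le_ofReal ?_
  rw [Finset.sum_const, Finset.card_univ, Fintype.card_fin, nsmul_eq_mul, mul_one_div]
  exact div_self_le_one _

/-- Since `G V` and `G Z` are independent if `Vᵀ Z = 0`, the pseudoinverse of `G V` amplifies `G Z`
by at most one in mean square. -/
lemma lintegral_norm_sq_leftInv_mul_le {p j q n : ℕ} (hpj : 2 * j + 1 ≤ p)
    {V : Matrix (Fin q) (Fin j) ℝ} (hV : Vᵀ * V = 1) {Z : Matrix (Fin q) (Fin n) ℝ}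
    (hZ : Vᵀ * Z = 0) :
    ∫⁻ G, ENNReal.ofReal (‖leftInv (G * V) * G * Z‖ ^ 2) ∂gaussMat (Fin p) (Fin q) ≤
      ENNReal.ofReal (‖Z‖ ^ 2) := by
  have hmV : Measurable fun G : Matrix (Fin p) (Fin q) ℝ => G * V :=
    measurable_matrix_mul measurable_id measurable_const
  have hm : Measurable fun G : Matrix (Fin p) (Fin q) ℝ =>
      ENNReal.ofReal (‖leftInv (G * V) * G * Z‖ ^ 2) :=
    ((measurable_matrix_norm (measurable_matrix_mul (measurable_matrix_mul
      (measurable_leftInv hmV) measurable_id) measurable_const)).pow_const 2).ennreal_ofReal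
  have hi : V * Vᵀ * (V * Vᵀ) = V * Vᵀ := by
    rw [Matrix.mul_assoc, ← Matrix.mul_assoc Vᵀ, hV, Matrix.one_mul]
  have hF : Measurable fun q : Matrix (Fin p) (Fin q) ℝ × Matrix (Fin p) (Fin q) ℝ =>
      q.1 * (V * Vᵀ) + q.2 * (1 - V * Vᵀ) := Continuous.measurable (by fun_prop)
  rw [← map_resample_gaussMat (P := V * Vᵀ) (by simp) hi, lintegral_map hm hF]
  refine (lintegral_prod _ (hm.comp hF).aemeasurable).trans_le ?_
  have h1 : ∀ G G' : Matrix (Fin p) (Fin q) ℝ, (G * (V * Vᵀ) + G' * (1 - V * Vᵀ)) * V = G * V := by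
    intro G G'
    rw [Matrix.add_mul, Matrix.mul_assoc, Matrix.mul_assoc V, hV, Matrix.mul_one, Matrix.mul_assoc,
      Matrix.sub_mul, Matrix.mul_assoc V, hV]
    simp
  have h2 : ∀ G G' : Matrix (Fin p) (Fin q) ℝ, (G * (V * Vᵀ) + G' * (1 - V * Vᵀ)) * Z = G' * Z := by
    intro G G'
    rw [Matrix.add_mul, Matrix.mul_assoc, Matrix.mul_assoc V, hZ, Matrix.mul_assoc,
      Matrix.sub_mul, Matrix.mul_assoc V, hZ]
    simp
  have h3 : ∀ G G' : Matrix (Fin p) (Fin q) ℝ, ‖leftInv ((G * (V * Vᵀ) + G' * (1 - V * Vᵀ)) * V) *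
      (G * (V * Vᵀ) + G' * (1 - V * Vᵀ)) * Z‖ = ‖leftInv (G * V) * G' * Z‖ := fun G G' => by
    rw [h1, Matrix.mul_assoc, h2, ← Matrix.mul_assoc]
  simp only [Function.comp_apply, h3]
  simp only [lintegral_norm_sq_mul_gaussMat]
  have hm2 : Measurable fun H : Matrix (Fin p) (Fin j) ℝ => ENNReal.ofReal (‖leftInv H‖ ^ 2) :=
    ((measurable_matrix_norm (measurable_leftInv measurable_id)).pow_const 2).ennreal_ofReal
  simp only [ENNReal.ofReal_mul (sq_nonneg _)]
  have hm3 : Measurable fun G : Matrix (Fin p) (Fin q) ℝ =>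
      ENNReal.ofReal (‖leftInv (G * V)‖ ^ 2) := hm2.comp hmV
  rw [lintegral_mul_const _ hm3,
    ← lintegral_map (f := fun H => ENNReal.ofReal (‖leftInv H‖ ^ 2)) hm2 hmV, map_mul_gaussMat hV]
  exact (mul_le_mul_left (lintegral_norm_sq_leftInv_le hpj) _).trans_eq (one_mul _)

end Pseudoinverse

/-! ### Null sets of Gaussian matrices -/

section NullSets

attribute [local instance] matrixMeasurableSpace matrix_borelSpace matrix_secondCountableTopology

lemma pi_absolutelyContinuous_pi (ι : Type*) [Fintype ι] {a b : Measure ℝ} [SigmaFinite a]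
    [SigmaFinite b] (h : a ≪ b) : (Measure.pi fun _ : ι => a) ≪ Measure.pi fun _ : ι => b := by
  refine Fintype.induction_empty_option
    (P := fun ι _ => (Measure.pi fun _ : ι => a) ≪ Measure.pi fun _ : ι => b) ?_ ?_ ?_ ι
  · intro α β _ e ih
    let _ : Fintype α := Fintype.ofEquiv β e.symm
    have h1 := (measurePreserving_piCongrLeft (fun _ : β => a) e).map_eq
    have h2 := (measurePreserving_piCongrLeft (fun _ : β => b) e).map_eq
    rw [← h1, ← h2]
    exact ih.map (MeasurableEquiv.measurable _)
  · rw [Measure.pi_of_empty, Measure.pi_of_empty]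
  · intro α _ ih
    rw [← Measure.pi_map_piOptionEquivProd, ← Measure.pi_map_piOptionEquivProd]
    exact (ih.prod h).map (MeasurableEquiv.measurable _)

variable {m n : Type*} [Fintype m] [Fintype n]

/-- A measurable set `N` of matrices is null for `gaussMat` if every curve `s ↦ c s + L s G` meets
it for almost no `s`, where the maps `L s` are linear and invertible for `s ≠ 0`: by Fubini, the
preimage of `N` under one of the maps `G ↦ c s + L s G` is Lebesgue null. -/
lemma gaussMat_eq_zero {N : Set (Matrix m n ℝ)} (hN : MeasurableSet N)
    {F : ℝ → Matrix m n ℝ → Matrix m n ℝ} (hF : Measurable (Function.uncurry F))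
    (c : ℝ → Matrix m n ℝ) (L : ℝ → (Matrix m n ℝ ≃ₗ[ℝ] Matrix m n ℝ))
    (hFL : ∀ s, s ≠ 0 → ∀ G, F s G = c s + L s G)
    (hae : ∀ G, ∀ᵐ s : ℝ, F s G ∉ N) : gaussMat m n N = 0 := by
  let e : (m × n → ℝ) ≃ₗ[ℝ] Matrix m n ℝ :=
    { toFun := toMatrix
      invFun := fun G p => G p.1 p.2
      map_add' := fun _ _ => rfl
      map_smul' := fun _ _ => rfl
      left_inv := fun _ => rfl
      right_inv := fun _ => rfl }
  have hac : (Measure.pi fun _ : m × n => gaussianReal 0 1) ≪ (volume : Measure (m × n → ℝ)) :=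
    pi_absolutelyContinuous_pi _ (gaussianReal_absolutelyContinuous 0 one_ne_zero)
  rw [gaussMat, Measure.map_apply measurable_toMatrix hN]
  refine hac ?_
  have hN' : MeasurableSet (toMatrix ⁻¹' N : Set (m × n → ℝ)) := measurable_toMatrix hN
  have hS : MeasurableSet {q : ℝ × (m × n → ℝ) | F q.1 (toMatrix q.2) ∈ N} :=
    (hF.comp (measurable_fst.prodMk (measurable_toMatrix.comp measurable_snd))) hN
  have h0 : ((volume : Measure ℝ).prod (volume : Measure (m × n → ℝ)))
      {q | F q.1 (toMatrix q.2) ∈ N} = 0 := by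
    rw [Measure.prod_apply_symm hS, lintegral_eq_zero_iff (measurable_measure_prodMk_right hS)]
    refine ae_of_all _ fun x => ?_
    have := hae (toMatrix x)
    rw [ae_iff] at this
    simpa using this
  have h1 := Measure.measure_ae_null_of_prod_null h0
  obtain ⟨s, hs, hs0⟩ := (h1.and (show ∀ᵐ s : ℝ, s ≠ 0 from Measure.ae_ne volume 0)).exists
  let L' := (e.trans (L s)).trans e.symm
  have h2 : (volume : Measure (m × n → ℝ)) (L' ⁻¹' ((fun x => e.symm (c s) + x) ⁻¹'
      (toMatrix ⁻¹' N))) = 0 := by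
    have h3 : {x : m × n → ℝ | F s (toMatrix x) ∈ N} = L' ⁻¹' ((fun x => e.symm (c s) + x) ⁻¹'
      (toMatrix ⁻¹' N)) := by
      ext x
      rw [Set.mem_ofPred_eq, hFL s hs0]; rfl
    rw [← h3]
    exact hs
  have hdet : LinearMap.det (L' : (m × n → ℝ) →ₗ[ℝ] (m × n → ℝ)) ≠ 0 :=
    (LinearEquiv.isUnit_det' L').ne_zero
  have h4 := Measure.addHaar_preimage_linearMap (volume : Measure (m × n → ℝ)) hdet
    ((fun x => e.symm (c s) + x) ⁻¹' (toMatrix ⁻¹' N))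
  rw [measure_preimage_add] at h4
  rw [LinearEquiv.coe_coe, h2] at h4
  rcases mul_eq_zero.1 h4.symm with h5 | h5
  · rw [ENNReal.ofReal_eq_zero] at h5
    exact absurd (abs_pos.2 (inv_ne_zero hdet)) (not_lt.2 h5)
  · exact h5

end NullSets

/-! ### Generic position of Gaussian sketches -/

section Generic

attribute [local instance] matrixMeasurableSpace matrix_borelSpace matrix_secondCountableTopology

/-- If `Λ` is affine along the lines through `G₀`, the Gram determinant of `Λ G` is a polynomial
along these lines. If it is not zero at `G₀`, it is almost surely not zero for a Gaussian matrix
`G`. -/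
lemma ae_det_gram_ne_zero {a b p k : Type*} [Fintype a] [Fintype b] [Fintype p] [Fintype k]
    [DecidableEq k] {Λ : Matrix a b ℝ → Matrix p k ℝ} (hm : Measurable Λ) {G₀ : Matrix a b ℝ}
    (hΛ : ∀ (s : ℝ) G, Λ (G₀ + s • G) = Λ G₀ + s • Λ G) (h₀ : ((Λ G₀)ᵀ * Λ G₀).det ≠ 0) :
    ∀ᵐ G ∂gaussMat a b, ((Λ G)ᵀ * Λ G).det ≠ 0 := by
  have hN : MeasurableSet {G : Matrix a b ℝ | ((Λ G)ᵀ * Λ G).det = 0} :=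
    measurable_det_gram hm (measurableSet_singleton 0)
  rw [ae_iff]
  simp only [ne_eq, not_not]
  refine gaussMat_eq_zero hN (F := fun s G => G₀ + s • G) ?_ (fun _ => G₀)
    (fun s => if h : s ≠ 0 then LinearEquiv.smulOfNeZero ℝ _ s h else LinearEquiv.refl ℝ _) ?_ ?_
  · exact Continuous.measurable (by fun_prop)
  · intro s hs G
    rw [dif_pos hs]; rfl
  · intro G
    let M : Matrix p k (Polynomial ℝ) :=
      (Λ G₀).map Polynomial.C + (Polynomial.X : Polynomial ℝ) • (Λ G).map Polynomial.C
    have hM : ∀ s : ℝ, (Mᵀ * M).det.eval s = ((Λ (G₀ + s • G))ᵀ * Λ (G₀ + s • G)).det := by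
      intro s
      rw [← Polynomial.coe_evalRingHom, RingHom.map_det, hΛ]
      congr 1
      rw [RingHom.mapMatrix_apply, Matrix.map_mul]
      congr 1 <;>
      · ext i j
        simp only [M, Matrix.map_apply, Matrix.transpose_apply, Matrix.add_apply,
          Matrix.smul_apply, smul_eq_mul, Polynomial.coe_evalRingHom, Polynomial.eval_add,
          Polynomial.eval_mul, Polynomial.eval_C, Polynomial.eval_X]
    have hne : (Mᵀ * M).det ≠ 0 := by
      intro h
      have := hM 0
      rw [h] at this
      simp only [Polynomial.eval_zero, zero_smul, add_zero] at this
      exact h₀ this.symm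
    have hfin := Polynomial.finite_setOfPred_isRoot hne
    rw [ae_iff]
    refine measure_mono_null (fun s hs => ?_) (hfin.measure_zero volume)
    simp only [not_not, Set.mem_ofPred_eq] at hs ⊢
    rw [Polynomial.IsRoot, hM]
    exact hs

/-- The first `k` of `l` standard basis vectors, as columns. -/
def stdColumns (l k : ℕ) : Matrix (Fin l) (Fin k) ℝ :=
  Matrix.of fun i a => if i.1 = a.1 then 1 else 0

lemma stdColumns_transpose_mul {l k : ℕ} (h : k ≤ l) :
    (stdColumns l k)ᵀ * stdColumns l k = 1 := by
  ext a b
  rw [Matrix.mul_apply, Matrix.one_apply, Finset.sum_eq_single (Fin.castLE h a)]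
  · simp [stdColumns, Fin.ext_iff]
  · intro i _ hi
    have : i.1 ≠ a.1 := fun h' => hi (Fin.ext h')
    simp [stdColumns, this]
  · simp

lemma ae_det_gram_mul_left {l m k : ℕ} (hkl : k ≤ l) {Y : Matrix (Fin m) (Fin k) ℝ}
    (hY : (Yᵀ * Y).det ≠ 0) :
    ∀ᵐ Psi ∂gaussMat (Fin l) (Fin m), ((Psi * Y)ᵀ * (Psi * Y)).det ≠ 0 := by
  refine ae_det_gram_ne_zero (Λ := fun Psi : Matrix (Fin l) (Fin m) ℝ => Psi * Y)
    (measurable_matrix_mul measurable_id measurable_const)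
    (G₀ := stdColumns l k * leftInv Y)
    (fun s G => by rw [Matrix.add_mul, Matrix.smul_mul]) ?_
  rw [Matrix.mul_assoc, leftInv_mul hY, Matrix.mul_one, stdColumns_transpose_mul hkl,
    Matrix.det_one]
  exact one_ne_zero

lemma ae_det_gram_transpose_mul {n k j : ℕ} (hjk : j ≤ k) {V : Matrix (Fin n) (Fin j) ℝ}
    (hV : Vᵀ * V = 1) :
    ∀ᵐ Om ∂gaussMat (Fin n) (Fin k), ((Omᵀ * V)ᵀ * (Omᵀ * V)).det ≠ 0 := by
  refine ae_det_gram_ne_zero (Λ := fun Om : Matrix (Fin n) (Fin k) ℝ => Omᵀ * V)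
    (measurable_matrix_mul (measurable_matrix_transpose measurable_id) measurable_const)
    (G₀ := V * (stdColumns k j)ᵀ)
    (fun s G => by rw [Matrix.transpose_add, Matrix.add_mul, Matrix.transpose_smul,
      Matrix.smul_mul]) ?_
  have : (V * (stdColumns k j)ᵀ)ᵀ * V = stdColumns k j := by
    rw [Matrix.transpose_mul, Matrix.transpose_transpose, Matrix.mul_assoc, hV, Matrix.mul_one]
  rw [this, stdColumns_transpose_mul hjk, Matrix.det_one]
  exact one_ne_zero

/-- If `A` has rank at least `k`, the `k` columns of `A Ω` are almost surely independent. -/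
lemma ae_det_gram_mul_right {m n k : ℕ} {A : Matrix (Fin m) (Fin n) ℝ} (hk : k ≤ A.rank) :
    ∀ᵐ Om ∂gaussMat (Fin n) (Fin k), ((A * Om)ᵀ * (A * Om)).det ≠ 0 := by
  obtain ⟨V, hV, -, S, hS⟩ := exists_orthonormal_range A
  refine ae_det_gram_ne_zero (Λ := fun Om : Matrix (Fin n) (Fin k) ℝ => A * Om)
    (measurable_matrix_mul measurable_const measurable_id)
    (G₀ := S * stdColumns A.rank k)
    (fun s G => by rw [Matrix.mul_add, Matrix.mul_smul]) ?_
  have : A * (S * stdColumns A.rank k) = V * stdColumns A.rank k := by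
    rw [← Matrix.mul_assoc, ← hS]
  rw [this, Matrix.transpose_mul, Matrix.mul_assoc, ← Matrix.mul_assoc Vᵀ, hV,
    Matrix.one_mul, stdColumns_transpose_mul hk, Matrix.det_one]
  exact one_ne_zero

/-- If `A` has rank at most `k`, then `A Ω` almost surely has the same column space as `A`. -/
lemma ae_exists_mul_mul_eq {m n k : ℕ} {A : Matrix (Fin m) (Fin n) ℝ} (hk : A.rank ≤ k) :
    ∀ᵐ Om ∂gaussMat (Fin n) (Fin k), ∃ T : Matrix (Fin k) (Fin n) ℝ, A * Om * T = A := by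
  obtain ⟨V, hV, hVA, -⟩ := exists_orthonormal_range Aᵀ
  filter_upwards [ae_det_gram_transpose_mul (k := k) (by rwa [Matrix.rank_transpose]) hV]
    with Om hOm
  have h1 : Vᵀ * Om * (leftInv (Omᵀ * V))ᵀ = 1 := by
    have := congrArg Matrix.transpose (leftInv_mul hOm)
    simpa [Matrix.transpose_mul] using this
  have h2 : A * V * Vᵀ = A := by
    have := congrArg Matrix.transpose hVA
    simpa [Matrix.transpose_mul, Matrix.mul_assoc] using this
  refine ⟨(leftInv (Omᵀ * V))ᵀ * Vᵀ, ?_⟩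
  calc A * Om * ((leftInv (Omᵀ * V))ᵀ * Vᵀ)
      = A * V * (Vᵀ * Om * (leftInv (Omᵀ * V))ᵀ) * Vᵀ := by
        trans A * V * Vᵀ * Om * ((leftInv (Omᵀ * V))ᵀ * Vᵀ)
        · rw [h2]
        · simp only [Matrix.mul_assoc]
    _ = A := by rw [h1, Matrix.mul_one, h2]

/-- The oblique projection onto a `k`-dimensional space given by a Gaussian matrix with more than
`2 k` rows amplifies the component orthogonal to this space by at most one in mean square. -/
lemma lintegral_norm_sq_obliqueProj_mul_le {l m n k : ℕ} (hkl : 2 * k + 1 ≤ l)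
    {Y : Matrix (Fin m) (Fin k) ℝ} (hY : (Yᵀ * Y).det ≠ 0) {Z : Matrix (Fin m) (Fin n) ℝ}
    (hZ : Yᵀ * Z = 0) :
    ∫⁻ Psi, ENNReal.ofReal (‖obliqueProj Y Psi * Z‖ ^ 2) ∂gaussMat (Fin l) (Fin m) ≤
      ENNReal.ofReal (‖Z‖ ^ 2) := by
  obtain ⟨V, hV, hVY, S, hS⟩ := exists_orthonormal_range Y
  have hr : Y.rank ≤ k := Matrix.rank_le_width Y
  have hVZ : Vᵀ * Z = 0 := by
    rw [hS, Matrix.transpose_mul, Matrix.mul_assoc, hZ, Matrix.mul_zero]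
  refine le_trans (lintegral_mono_ae ?_) (lintegral_norm_sq_leftInv_mul_le
    (p := l) (j := Y.rank) (by omega) hV hVZ)
  filter_upwards [ae_det_gram_mul_left (l := l) (by omega) hY,
    ae_det_gram_mul_left (l := l) (by omega) (Y := V)
      (by rw [hV, Matrix.det_one]; exact one_ne_zero)]
    with Psi h1 h2
  have h3 := mul_pseudoinverse_mul_eq h1 hS hVY.symm (mulVec_eq_zero_of_transpose_mul_self hV)
    (isPseudoinverse_leftInv h2)
  rw [obliqueProj, ← h3, Matrix.mul_assoc, Matrix.mul_assoc V, ← Matrix.mul_assoc (leftInv _),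
    norm_mul_of_transpose_mul_self hV]

/-- For almost every `Ψ`, the best approximations of the oblique projection of `X` onto a given
space all have the same distance to `X`. The part `Ψ (1 - P)` of the test matrix, where `P` is the
orthogonal projection onto the space, can be scaled by `s` without changing null sets; this moves
the oblique projection of `X` along a line through `P X`. -/
lemma ae_obliqueProj_mul_notMem_ambiguousSet {l m n k : ℕ} (r : ℕ) (hkl : k ≤ l)
    {Y : Matrix (Fin m) (Fin k) ℝ} (hY : (Yᵀ * Y).det ≠ 0) (X : Matrix (Fin m) (Fin n) ℝ) :
    ∀ᵐ Psi ∂gaussMat (Fin l) (Fin m), obliqueProj Y Psi * X ∉ ambiguousSet r X := by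
  set P := colProj Y with hP
  have hs : Pᵀ = P := colProj_transpose Y
  have hi : P * P = P := colProj_mul_self hY
  have hPY : P * Y = Y := colProj_mul hY
  suffices h : ∀ᵐ Psi ∂gaussMat (Fin l) (Fin m),
      ¬ (((Psi * Y)ᵀ * (Psi * Y)).det ≠ 0 ∧ obliqueProj Y Psi * X ∈ ambiguousSet r X) by
    filter_upwards [h, ae_det_gram_mul_left (l := l) hkl hY] with Psi h1 h2 h3
    exact h1 ⟨h2, h3⟩
  have hN : MeasurableSet {Psi : Matrix (Fin l) (Fin m) ℝ |
      ((Psi * Y)ᵀ * (Psi * Y)).det ≠ 0 ∧ obliqueProj Y Psi * X ∈ ambiguousSet r X} := by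
    refine MeasurableSet.inter ?_ ?_
    · exact (measurable_det_gram (measurable_matrix_mul measurable_id measurable_const))
        (measurableSet_singleton 0).compl
    · exact (measurable_matrix_mul (measurable_obliqueProj measurable_const measurable_id)
        measurable_const) (measurableSet_ambiguousSet r X)
  rw [ae_iff]
  simp only [not_not]
  have key : ∀ (s u : ℝ) (G : Matrix (Fin l) (Fin m) ℝ),
      (G * P + s • (G * (1 - P))) * P + u • ((G * P + s • (G * (1 - P))) * (1 - P)) =
        G * P + (u * s) • (G * (1 - P)) := by
    intro s u G
    have e1 : (1 - P) * P = 0 := by rw [Matrix.sub_mul, hi]; simp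
    have e2 : P * (1 - P) = 0 := by rw [Matrix.mul_sub, hi]; simp
    have e3 : (1 - P) * (1 - P) = 1 - P := by rw [Matrix.mul_sub, e1]; simp
    simp only [Matrix.add_mul, Matrix.smul_mul, Matrix.mul_assoc, hi, e1, e2, e3, Matrix.mul_zero,
      smul_zero, add_zero, zero_add, smul_smul]
  have key1 : ∀ G : Matrix (Fin l) (Fin m) ℝ, G * P + (1 : ℝ) • (G * (1 - P)) = G := by
    intro G
    rw [one_smul, ← Matrix.mul_add, add_sub_cancel, Matrix.mul_one]
  let L : ∀ s : ℝ, s ≠ 0 → (Matrix (Fin l) (Fin m) ℝ ≃ₗ[ℝ] Matrix (Fin l) (Fin m) ℝ) := fun s h =>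
    { toFun := fun G => G * P + s • (G * (1 - P))
      invFun := fun G => G * P + s⁻¹ • (G * (1 - P))
      map_add' := fun G G' => by simp only [Matrix.add_mul, smul_add]; abel
      map_smul' := fun c G => by
        simp only [Matrix.smul_mul, smul_add, RingHom.id_apply, smul_comm s c]
      left_inv := fun G => by beta_reduce; rw [key, inv_mul_cancel₀ h, key1]
      right_inv := fun G => by beta_reduce; rw [key, mul_inv_cancel₀ h, key1] }
  refine gaussMat_eq_zero hN (F := fun s G => G * P + s • (G * (1 - P))) ?_ (fun _ => 0)
    (fun s => if h : s ≠ 0 then L s h else LinearEquiv.refl ℝ _) ?_ ?_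
  · exact Continuous.measurable (by fun_prop)
  · intro s h G
    rw [dif_pos h, zero_add]; rfl
  · intro G
    have hGY : ∀ s : ℝ, (G * P + s • (G * (1 - P))) * Y = G * Y := by
      intro s
      rw [Matrix.add_mul, Matrix.smul_mul, Matrix.mul_assoc, hPY, Matrix.mul_assoc G,
        Matrix.sub_mul, hPY]
      simp
    by_cases hG : ((G * Y)ᵀ * (G * Y)).det = 0
    -- Scaling does not change `Ψ Y`, so this case is excluded for all `s` at once.
    · refine ae_of_all _ fun s hs => hs.1 ?_
      simp only [hGY]
      exact hG
    have hline : ∀ s : ℝ, obliqueProj Y (G * P + s • (G * (1 - P))) * X =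
        P * X + s • (obliqueProj Y G * ((1 - P) * X)) := by
      intro s
      have h1 : Y * leftInv (G * Y) * (G * P) = P := by
        rw [hP, colProj, ← Matrix.mul_assoc G, Matrix.mul_assoc Y,
          ← Matrix.mul_assoc (leftInv _), leftInv_mul hG, Matrix.one_mul]
      rw [obliqueProj, hGY, Matrix.mul_add, h1, obliqueProj, Matrix.add_mul]
      simp only [Matrix.mul_smul, Matrix.smul_mul, Matrix.mul_assoc]
    have hE : P * (obliqueProj Y G * ((1 - P) * X)) = obliqueProj Y G * ((1 - P) * X) :=
      colProj_mul_obliqueProj_mul hY _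
    have hae := ae_notMem_ambiguousSet (r := r) (X := X) (C := P * X)
      (E := obliqueProj Y G * ((1 - P) * X)) fun s D hD => by
        have hPD : P * D = D := hD.proj_mul hs hi (by
          rw [Matrix.mul_add, ← Matrix.mul_assoc, hi, Matrix.mul_smul, hE])
        rw [Matrix.transpose_mul, hs, Matrix.mul_assoc, hPD]
    filter_upwards [hae] with s hs' hs''
    refine hs' ?_
    rw [← hline]
    exact hs''.2

end Generic

/-! ### The error of the reconstruction for a pair of test matrices -/

section Joint

attribute [local instance] matrixMeasurableSpace matrix_borelSpace matrix_secondCountableTopology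

variable {m n k l : ℕ} {A : Matrix (Fin m) (Fin n) ℝ}

/-- The joint law of the test matrices `Ω` and `Ψ`. -/
noncomputable abbrev testLaw (m n k l : ℕ) :
    Measure (Matrix (Fin n) (Fin k) ℝ × Matrix (Fin l) (Fin m) ℝ) :=
  (gaussMat (Fin n) (Fin k)).prod (gaussMat (Fin l) (Fin m))

lemma measurable_mul_fst (A : Matrix (Fin m) (Fin n) ℝ) :
    Measurable fun q : Matrix (Fin n) (Fin k) ℝ × Matrix (Fin l) (Fin m) ℝ => A * q.1 :=
  measurable_matrix_mul measurable_const measurable_fst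

lemma measurable_obliqueProj_mul (A : Matrix (Fin m) (Fin n) ℝ) :
    Measurable fun q : Matrix (Fin n) (Fin k) ℝ × Matrix (Fin l) (Fin m) ℝ =>
      obliqueProj (A * q.1) q.2 * A :=
  measurable_matrix_mul (measurable_obliqueProj (measurable_mul_fst A) measurable_snd)
    measurable_const

/-- The error `Y (Ψ Y)† Ψ (1 - Π) A` of the oblique projection of `A` onto the column space of
`Y = A Ω`, compared with the orthogonal projection `Π`. -/
noncomputable def obliqueError (A : Matrix (Fin m) (Fin n) ℝ)
    (q : Matrix (Fin n) (Fin k) ℝ × Matrix (Fin l) (Fin m) ℝ) : Matrix (Fin m) (Fin n) ℝ :=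
  obliqueProj (A * q.1) q.2 * ((1 - colProj (A * q.1)) * A)

lemma measurable_residual {α : Type*} [MeasurableSpace α] {F : α → Matrix (Fin m) (Fin k) ℝ}
    (hF : Measurable F) (A : Matrix (Fin m) (Fin n) ℝ) :
    Measurable fun x => (1 - colProj (F x)) * A :=
  measurable_matrix_mul ((show Continuous fun P : Matrix (Fin m) (Fin m) ℝ => 1 - P by
    fun_prop).measurable.comp (measurable_colProj hF)) measurable_const

lemma measurable_obliqueError (A : Matrix (Fin m) (Fin n) ℝ) :
    Measurable (obliqueError (k := k) (l := l) A) :=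
  measurable_matrix_mul (measurable_obliqueProj (measurable_mul_fst A) measurable_snd)
    (measurable_residual (measurable_mul_fst A) A)

lemma ae_testLaw_det_gram (hkl : k ≤ l) (hk : k ≤ A.rank) :
    ∀ᵐ q ∂testLaw m n k l, ((q.2 * (A * q.1))ᵀ * (q.2 * (A * q.1))).det ≠ 0 := by
  refine (Measure.ae_prod_iff_ae_ae ?_).2 ?_
  · exact measurable_det_gram (measurable_matrix_mul measurable_snd (measurable_mul_fst A))
      (measurableSet_singleton 0).compl
  · filter_upwards [ae_det_gram_mul_right hk] with Om hOm
    exact ae_det_gram_mul_left hkl hOm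

lemma ae_testLaw_notMem_ambiguousSet (r : ℕ) (hkl : k ≤ l) (hk : k ≤ A.rank) :
    ∀ᵐ q ∂testLaw m n k l, obliqueProj (A * q.1) q.2 * A ∉ ambiguousSet r A := by
  refine (Measure.ae_prod_iff_ae_ae ?_).2 ?_
  · exact measurable_obliqueProj_mul A (measurableSet_ambiguousSet r A).compl
  · filter_upwards [ae_det_gram_mul_right hk] with Om hOm
    exact ae_obliqueProj_mul_notMem_ambiguousSet r hkl hOm A

lemma lintegral_norm_sq_obliqueError_le (hkl : 2 * k + 1 ≤ l) (hk : k ≤ A.rank) :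
    ∫⁻ q, ENNReal.ofReal (‖obliqueError A q‖ ^ 2) ∂testLaw m n k l ≤
      ∫⁻ Om, ENNReal.ofReal (‖(1 - colProj (A * Om)) * A‖ ^ 2) ∂gaussMat (Fin n) (Fin k) := by
  have hm : Measurable fun q : Matrix (Fin n) (Fin k) ℝ × Matrix (Fin l) (Fin m) ℝ =>
      ENNReal.ofReal (‖obliqueError A q‖ ^ 2) :=
    ((measurable_matrix_norm (measurable_obliqueError A)).pow_const 2).ennreal_ofReal
  rw [lintegral_prod _ hm.aemeasurable]
  refine lintegral_mono_ae ?_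
  filter_upwards [ae_det_gram_mul_right hk] with Om hOm
  have h := lintegral_norm_sq_obliqueProj_mul_le hkl hOm (transpose_mul_one_sub_colProj hOm A)
  simpa only [obliqueError] using h

/-- The mean square of `‖M - A‖` for the oblique projection `M` of `A`. -/
lemma lintegral_norm_sq_obliqueProj_sub_le (hkl : 2 * k + 1 ≤ l) (hk : k ≤ A.rank) :
    ∫⁻ q, ENNReal.ofReal (‖obliqueProj (A * q.1) q.2 * A - A‖ ^ 2) ∂testLaw m n k l ≤
      2 * ∫⁻ Om, ENNReal.ofReal (‖(1 - colProj (A * Om)) * A‖ ^ 2)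
        ∂gaussMat (Fin n) (Fin k) := by
  have hm : Measurable fun q : Matrix (Fin n) (Fin k) ℝ × Matrix (Fin l) (Fin m) ℝ =>
      ENNReal.ofReal (‖obliqueError A q‖ ^ 2) :=
    ((measurable_matrix_norm (measurable_obliqueError A)).pow_const 2).ennreal_ofReal
  have hm2 : Measurable fun Om : Matrix (Fin n) (Fin k) ℝ =>
      ENNReal.ofReal (‖(1 - colProj (A * Om)) * A‖ ^ 2) :=
    ((measurable_matrix_norm (measurable_residual
      (measurable_matrix_mul measurable_const measurable_id) A)).pow_const 2).ennreal_ofReal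
  calc ∫⁻ q, ENNReal.ofReal (‖obliqueProj (A * q.1) q.2 * A - A‖ ^ 2) ∂testLaw m n k l
      ≤ ∫⁻ q, (ENNReal.ofReal (‖obliqueError A q‖ ^ 2) +
          ENNReal.ofReal (‖(1 - colProj (A * q.1)) * A‖ ^ 2)) ∂testLaw m n k l := by
        refine lintegral_mono_ae ?_
        filter_upwards [ae_testLaw_det_gram (by omega) hk] with q hq
        rw [norm_sq_obliqueProj_mul_sub hq, ENNReal.ofReal_add (by positivity) (by positivity)]
        exact le_rfl
    _ = ∫⁻ q, ENNReal.ofReal (‖obliqueError A q‖ ^ 2) ∂testLaw m n k l +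
          ∫⁻ Om, ENNReal.ofReal (‖(1 - colProj (A * Om)) * A‖ ^ 2)
            ∂gaussMat (Fin n) (Fin k) := by
        rw [lintegral_add_left hm]
        congr 1
        have h := (measurePreserving_fst (μ := gaussMat (Fin n) (Fin k))
          (ν := gaussMat (Fin l) (Fin m))).lintegral_comp hm2
        exact h
    _ ≤ _ := by
        rw [two_mul]
        gcongr
        exact lintegral_norm_sq_obliqueError_le hkl hk

lemma lintegral_norm_sq_residual_le_norm (hk : k ≤ A.rank) :
    ∫⁻ Om, ENNReal.ofReal (‖(1 - colProj (A * Om)) * A‖ ^ 2) ∂gaussMat (Fin n) (Fin k) ≤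
      ENNReal.ofReal (‖A‖ ^ 2) := by
  refine (lintegral_mono_ae (g := fun _ => ENNReal.ofReal (‖A‖ ^ 2)) ?_).trans_eq
    (by rw [lintegral_const, measure_univ, mul_one])
  filter_upwards [ae_det_gram_mul_right hk] with Om hOm
  exact ENNReal.ofReal_le_ofReal
    (pow_le_pow_left₀ (norm_nonneg _) (norm_one_sub_colProj_mul_le_norm hOm A) 2)

/-- A mean square bound implies a bound for the mean. No measurability is needed. -/
lemma lintegral_ofReal_le_of_sq {α : Type*} [MeasurableSpace α] {μ : Measure α}
    [IsProbabilityMeasure μ] {f : α → ℝ} {c : ℝ} (hc : 0 ≤ c)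
    (h : ∫⁻ x, ENNReal.ofReal (f x ^ 2) ∂μ ≤ ENNReal.ofReal (c ^ 2)) :
    ∫⁻ x, ENNReal.ofReal (f x) ∂μ ≤ ENNReal.ofReal c := by
  have key : ∀ e : ℝ, 0 < e → ∫⁻ x, ENNReal.ofReal (f x) ∂μ ≤ ENNReal.ofReal (c + e) := by
    intro e he
    have hce : 0 < 2 * (c + e) := by positivity
    calc ∫⁻ x, ENNReal.ofReal (f x) ∂μ
        ≤ ∫⁻ x, (ENNReal.ofReal (1 / (2 * (c + e))) * ENNReal.ofReal (f x ^ 2) +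
            ENNReal.ofReal ((c + e) / 2)) ∂μ := by
          refine lintegral_mono fun x => ?_
          rw [← ENNReal.ofReal_mul (by positivity),
            ← ENNReal.ofReal_add (by positivity) (by positivity)]
          refine ENNReal.ofReal_le_ofReal ?_
          -- the inequality `2 a b ≤ a² + b²`
          have : 1 / (2 * (c + e)) * f x ^ 2 + (c + e) / 2 - f x =
              (f x - (c + e)) ^ 2 / (2 * (c + e)) := by field_simp; ring
          have h2 : 0 ≤ (f x - (c + e)) ^ 2 / (2 * (c + e)) := by positivity
          linarith
      _ = ENNReal.ofReal (1 / (2 * (c + e))) * ∫⁻ x, ENNReal.ofReal (f x ^ 2) ∂μ +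
            ENNReal.ofReal ((c + e) / 2) := by
          rw [lintegral_add_right _ measurable_const,
            lintegral_const_mul' _ _ ENNReal.ofReal_ne_top, lintegral_const, measure_univ, mul_one]
      _ ≤ ENNReal.ofReal (1 / (2 * (c + e))) * ENNReal.ofReal (c ^ 2) +
            ENNReal.ofReal ((c + e) / 2) := by gcongr
      _ ≤ ENNReal.ofReal (c + e) := by
          rw [← ENNReal.ofReal_mul (by positivity),
            ← ENNReal.ofReal_add (by positivity) (by positivity)]
          refine ENNReal.ofReal_le_ofReal ?_
          have : 1 / (2 * (c + e)) * c ^ 2 ≤ (c + e) / 2 := by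
            rw [div_mul_eq_mul_div, one_mul, div_le_div_iff₀ hce two_pos]
            nlinarith
          linarith
  have hlim : Tendsto (fun e : ℝ => ENNReal.ofReal (c + e)) (𝓝[>] 0) (𝓝 (ENNReal.ofReal c)) := by
    have : Tendsto (fun e : ℝ => ENNReal.ofReal (c + e)) (𝓝 0) (𝓝 (ENNReal.ofReal (c + 0))) :=
      (ENNReal.continuous_ofReal.comp (continuous_const.add continuous_id)).tendsto 0
    rw [add_zero] at this
    exact this.mono_left nhdsWithin_le_nhds
  exact ge_of_tendsto hlim (eventually_mem_nhdsWithin.mono fun e he => key e he)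

/-- The approximation `A Ω (V₁ᵀ Ω)† V₁ᵀ` of `A`, where the columns of `V₁` are an orthonormal basis
of the row space of a best rank-`r` approximation `Ar`: it has rank at most `r`, its columns are in
the range of `A Ω`, and its mean square error is at most `2 ‖A - Ar‖²`. -/
lemma exists_competitor {r : ℕ} (hrk : 2 * r + 1 ≤ k) {Ar : Matrix (Fin m) (Fin n) ℝ}
    (hAr : IsBestRankApprox r A Ar) :
    ∃ C : Matrix (Fin n) (Fin k) ℝ → Matrix (Fin k) (Fin n) ℝ, Measurable C ∧
      (∀ Om, (C Om).rank ≤ r) ∧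
      ∫⁻ Om, ENNReal.ofReal (‖A - A * Om * C Om‖ ^ 2) ∂gaussMat (Fin n) (Fin k) ≤
        ENNReal.ofReal (2 * ‖A - Ar‖ ^ 2) := by
  obtain ⟨V, hV, hVA, S, hS⟩ := exists_orthonormal_range Arᵀ
  have hρr : Arᵀ.rank ≤ r := by rw [Matrix.rank_transpose]; exact hAr.1
  set B := A - Ar with hB
  have hBV : B * V = 0 := by rw [hS, ← Matrix.mul_assoc, hAr.sub_mul_transpose, Matrix.zero_mul]
  have hArV : Ar * V * Vᵀ = Ar := by
    have := congrArg Matrix.transpose hVA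
    simpa [Matrix.transpose_mul, Matrix.mul_assoc] using this
  have hmT : Measurable fun Om : Matrix (Fin n) (Fin k) ℝ => (leftInv (Omᵀ * V))ᵀ :=
    measurable_matrix_transpose (measurable_leftInv
      (measurable_matrix_mul (measurable_matrix_transpose measurable_id) measurable_const))
  refine ⟨fun Om => (leftInv (Omᵀ * V))ᵀ * Vᵀ, measurable_matrix_mul hmT measurable_const,
    fun Om => ?_, ?_⟩
  · refine (Matrix.rank_mul_le_right _ _).trans ?_
    rw [Matrix.rank_transpose]
    exact (Matrix.rank_le_width V).trans hρr
  have hpt : ∀ᵐ Om ∂gaussMat (Fin n) (Fin k),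
      ENNReal.ofReal (‖A - A * Om * ((leftInv (Omᵀ * V))ᵀ * Vᵀ)‖ ^ 2) ≤
        ENNReal.ofReal (‖B‖ ^ 2) + ENNReal.ofReal (‖leftInv (Omᵀ * V) * Omᵀ * Bᵀ‖ ^ 2) := by
    filter_upwards [ae_det_gram_transpose_mul (k := k) (by omega) hV] with Om hOm
    set T := (leftInv (Omᵀ * V))ᵀ with hT
    have h1 : Vᵀ * Om * T = 1 := by
      have := congrArg Matrix.transpose (leftInv_mul hOm)
      simpa [Matrix.transpose_mul] using this
    have h2 : A - A * Om * (T * Vᵀ) = B + -(B * Om * T) * Vᵀ := by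
      have h3 : Ar * Om * (T * Vᵀ) = Ar := by
        calc Ar * Om * (T * Vᵀ) = Ar * V * Vᵀ * Om * (T * Vᵀ) := by rw [hArV]
          _ = Ar * V * (Vᵀ * Om * T) * Vᵀ := by simp only [Matrix.mul_assoc]
          _ = Ar := by rw [h1, Matrix.mul_one, hArV]
      have h4 : A = Ar + B := by rw [hB]; abel
      have h5 : A * Om * (T * Vᵀ) = Ar + B * Om * (T * Vᵀ) := by
        conv_lhs => rw [h4]
        rw [Matrix.add_mul, Matrix.add_mul, h3]
      rw [h5, Matrix.neg_mul, Matrix.mul_assoc _ T, hB]; abel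
    have h6 : ‖leftInv (Omᵀ * V) * Omᵀ * Bᵀ‖ = ‖B * Om * T‖ := by
      rw [← Matrix.frobenius_norm_transpose]
      simp [Matrix.transpose_mul, hT, Matrix.mul_assoc]
    rw [h2, norm_add_sq_of_mul_transpose_eq_zero, norm_mul_transpose_of_transpose_mul_self hV,
      norm_neg, h6, ENNReal.ofReal_add (by positivity) (by positivity)]
    rw [Matrix.transpose_mul, Matrix.transpose_transpose, ← Matrix.mul_assoc, hBV, Matrix.zero_mul]
  refine (lintegral_mono_ae hpt).trans ?_
  rw [lintegral_add_left measurable_const, lintegral_const, measure_univ, mul_one, two_mul,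
    ENNReal.ofReal_add (by positivity) (by positivity)]
  gcongr
  have hVB : Vᵀ * Bᵀ = 0 := by rw [← Matrix.transpose_mul, hBV, Matrix.transpose_zero]
  have hm : Measurable fun G : Matrix (Fin k) (Fin n) ℝ =>
      ENNReal.ofReal (‖leftInv (G * V) * G * Bᵀ‖ ^ 2) :=
    ((measurable_matrix_norm (measurable_matrix_mul (measurable_matrix_mul (measurable_leftInv
      (measurable_matrix_mul measurable_id measurable_const)) measurable_id)
        measurable_const)).pow_const 2).ennreal_ofReal
  have hmt : Measurable fun G : Matrix (Fin n) (Fin k) ℝ => Gᵀ :=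
    measurable_matrix_transpose measurable_id
  rw [← lintegral_map (f := fun G : Matrix (Fin k) (Fin n) ℝ =>
    ENNReal.ofReal (‖leftInv (G * V) * G * Bᵀ‖ ^ 2)) hm hmt, map_transpose_gaussMat,
    ← Matrix.frobenius_norm_transpose B]
  exact lintegral_norm_sq_leftInv_mul_le (by omega) hV hVB

/-- Best rank-`r` approximations of the oblique projection of `A` are almost surely within a random
distance of `A` whose expectation is at most `3 √2 ‖A - Ar‖`. -/
lemma exists_error_bound {r : ℕ} (hrk : 2 * r + 1 ≤ k) (hkl : 2 * k + 1 ≤ l) (hk : k ≤ A.rank)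
    {Ar : Matrix (Fin m) (Fin n) ℝ} (hAr : IsBestRankApprox r A Ar) :
    ∃ b : Matrix (Fin n) (Fin k) ℝ × Matrix (Fin l) (Fin m) ℝ → ℝ, Measurable b ∧
      (∀ᵐ q ∂testLaw m n k l, ∀ D, IsBestRankApprox r (obliqueProj (A * q.1) q.2 * A) D →
        ‖D - A‖ ≤ b q) ∧
      ∫⁻ q, ENNReal.ofReal (b q) ∂testLaw m n k l ≤ ENNReal.ofReal (3 * √2 * ‖A - Ar‖) := by
  obtain ⟨C, hCm, hCr, hC⟩ := exists_competitor hrk hAr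
  set c := √2 * ‖A - Ar‖ with hc
  have hc0 : 0 ≤ c := by positivity
  have hc2 : 2 * ‖A - Ar‖ ^ 2 = c ^ 2 := by
    rw [hc, mul_pow, Real.sq_sqrt (by norm_num)]
  rw [hc2] at hC
  have hZm : Measurable fun Om : Matrix (Fin n) (Fin k) ℝ => ‖A - A * Om * C Om‖ :=
    measurable_matrix_norm ((show Continuous fun Z : Matrix (Fin m) (Fin n) ℝ => A - Z by
      fun_prop).measurable.comp (measurable_matrix_mul
        (measurable_matrix_mul measurable_const measurable_id) hCm))
  have hEm := measurable_matrix_norm (measurable_obliqueError (k := k) (l := l) A)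
  refine ⟨fun q => ‖A - A * q.1 * C q.1‖ + 2 * ‖obliqueError A q‖,
    (hZm.comp measurable_fst).add (hEm.const_mul 2), ?_, ?_⟩
  · filter_upwards [ae_testLaw_det_gram (by omega) hk] with q hq D hD
    have hY := det_gram_ne_zero_of_mul hq
    rw [obliqueProj_mul_eq hq] at hD
    rw [norm_sub_rev]
    refine hD.norm_sub_le_of_proj (colProj_transpose _) (colProj_mul_self hY)
      (colProj_mul_obliqueProj_mul hY _) ?_ ?_
    · rw [← Matrix.mul_assoc, colProj_mul hY]
    · exact (Matrix.rank_mul_le_right _ _).trans (hCr _)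
  · have hE : ∫⁻ q, ENNReal.ofReal (‖obliqueError A q‖ ^ 2) ∂testLaw m n k l ≤
        ENNReal.ofReal (c ^ 2) := by
      refine (lintegral_norm_sq_obliqueError_le hkl hk).trans (le_trans (lintegral_mono_ae ?_) hC)
      filter_upwards [ae_det_gram_mul_right hk] with Om hOm
      exact ENNReal.ofReal_le_ofReal (pow_le_pow_left₀ (norm_nonneg _)
        (norm_one_sub_colProj_mul_le hOm A (C Om)) 2)
    have e1 := lintegral_ofReal_le_of_sq hc0 hC
    have e2 := lintegral_ofReal_le_of_sq hc0 hE
    have hm1 : Measurable fun q : Matrix (Fin n) (Fin k) ℝ × Matrix (Fin l) (Fin m) ℝ =>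
      ENNReal.ofReal ‖A - A * q.1 * C q.1‖ := (hZm.comp measurable_fst).ennreal_ofReal
    have h1 : ∫⁻ q, ENNReal.ofReal ‖A - A * q.1 * C q.1‖ ∂testLaw m n k l =
        ∫⁻ Om, ENNReal.ofReal ‖A - A * Om * C Om‖ ∂gaussMat (Fin n) (Fin k) :=
      (measurePreserving_fst (μ := gaussMat (Fin n) (Fin k))
          (ν := gaussMat (Fin l) (Fin m))).lintegral_comp hZm.ennreal_ofReal
    have h2 : ∀ q : Matrix (Fin n) (Fin k) ℝ × Matrix (Fin l) (Fin m) ℝ,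
        ENNReal.ofReal (‖A - A * q.1 * C q.1‖ + 2 * ‖obliqueError A q‖) =
        ENNReal.ofReal ‖A - A * q.1 * C q.1‖ +
          ENNReal.ofReal 2 * ENNReal.ofReal ‖obliqueError A q‖ := fun q => by
      rw [ENNReal.ofReal_add (by positivity) (by positivity), ENNReal.ofReal_mul (by positivity)]
    simp_rw [h2]
    rw [lintegral_add_left hm1, lintegral_const_mul _ hEm.ennreal_ofReal, h1]
    calc _ ≤ ENNReal.ofReal c + ENNReal.ofReal 2 * ENNReal.ofReal c := by gcongr
      _ = ENNReal.ofReal (3 * √2 * ‖A - Ar‖) := by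
        rw [← ENNReal.ofReal_mul (by positivity), ← ENNReal.ofReal_add (by positivity)
          (by positivity)]
        congr 1; rw [hc]; ring

end Joint

/-! ### Convergence of the reconstructions -/

section Convergence

attribute [local instance] matrixMeasurableSpace matrix_borelSpace matrix_secondCountableTopology

variable {Ω : Type*} [MeasurableSpace Ω] {μ : Measure Ω}

lemma aemeasurable_matrix {m n : ℕ} {G : Ω → Matrix (Fin m) (Fin n) ℝ}
    (h : ∀ i j, AEMeasurable (fun ω => G ω i j) μ) : AEMeasurable G μ :=
  aemeasurable_pi_iff.2 fun i => aemeasurable_pi_iff.2 fun j => h i j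

lemma IsStandardNormal.aemeasurable_and_map_eq {a b : ℕ} {G : Ω → Matrix (Fin a) (Fin b) ℝ}
    (h : IsStandardNormal G μ) : AEMeasurable G μ ∧ μ.map G = gaussMat (Fin a) (Fin b) := by
  have h1 : G = toMatrix ∘ fun ω (ij : Fin a × Fin b) => G ω ij.1 ij.2 := rfl
  have h2 : HasLaw (fun ω (ij : Fin a × Fin b) => G ω ij.1 ij.2)
    (Measure.pi fun _ : Fin a × Fin b => gaussianReal 0 1) μ := h
  refine ⟨?_, ?_⟩
  · rw [h1]; exact measurable_toMatrix.comp_aemeasurable h2.aemeasurable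
  · rw [gaussMat, ← h2.map_eq, AEMeasurable.map_map_of_aemeasurable
      measurable_toMatrix.aemeasurable h2.aemeasurable]
    rfl

lemma map_prodMk_eq_testLaw [IsProbabilityMeasure μ] {m n k l : ℕ}
    {Om : Ω → Matrix (Fin n) (Fin k) ℝ} {Psi : Ω → Matrix (Fin l) (Fin m) ℝ}
    (hOm : IsStandardNormal Om μ) (hPsi : IsStandardNormal Psi μ) (h : IndepMatrices Om Psi μ) :
    AEMeasurable (fun ω => (Om ω, Psi ω)) μ ∧
      μ.map (fun ω => (Om ω, Psi ω)) = testLaw m n k l := by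
  obtain ⟨hm, hl⟩ := hOm.aemeasurable_and_map_eq
  obtain ⟨hm', hl'⟩ := hPsi.aemeasurable_and_map_eq
  refine ⟨hm.prodMk hm', ?_⟩
  have h2 : IndepFun Om Psi μ := IndepFun.comp (φ := toMatrix) (ψ := toMatrix) h
    measurable_toMatrix measurable_toMatrix
  rw [(indepFun_iff_map_prod_eq_prod_map_map hm hm').1 h2, hl, hl']

/-- `Xhat` is almost surely a best approximation of the oblique projection of `A`, and of `A` itself
if the rank of `A` is so small that the sketch determines `A`. -/
lemma ae_isBestRankApprox {m n k l r : ℕ} (hkl : k ≤ l) {A : Matrix (Fin m) (Fin n) ℝ}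
    {Om : Ω → Matrix (Fin n) (Fin k) ℝ} {Psi : Ω → Matrix (Fin l) (Fin m) ℝ}
    (hm : AEMeasurable (fun ω => (Om ω, Psi ω)) μ)
    (hlaw : μ.map (fun ω => (Om ω, Psi ω)) = testLaw m n k l)
    {Xhat : Ω → Matrix (Fin m) (Fin n) ℝ}
    (hX : ∀ᵐ ω ∂μ, IsReconstruction r (Psi ω) (A * Om ω) (Psi ω * A) (Xhat ω)) :
    (k ≤ A.rank → ∀ᵐ ω ∂μ,
      IsBestRankApprox r (obliqueProj (A * Om ω) (Psi ω) * A) (Xhat ω)) ∧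
    (A.rank ≤ k → ∀ᵐ ω ∂μ, IsBestRankApprox r A (Xhat ω)) := by
  constructor
  · intro hk
    have h1 := ae_of_ae_map hm (hlaw ▸ ae_testLaw_det_gram hkl hk)
    filter_upwards [hX, h1] with ω h2 h3
    have h4 := h2.isBestRankApprox h3
    rw [obliqueProj, Matrix.mul_assoc _ (Psi ω)]
    exact h4
  · intro hk
    obtain ⟨V, hV, hVA, -⟩ := exists_orthonormal_range A
    have hOm : ∀ᵐ q ∂testLaw m n k l, ∃ T, A * q.1 * T = A :=
      Measure.quasiMeasurePreserving_fst.ae (ae_exists_mul_mul_eq hk)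
    have hPsi : ∀ᵐ q ∂testLaw m n k l, ((q.2 * V)ᵀ * (q.2 * V)).det ≠ 0 :=
      Measure.quasiMeasurePreserving_snd.ae (ae_det_gram_mul_left (hk.trans hkl)
        (by rw [hV, Matrix.det_one]; exact one_ne_zero))
    rw [← hlaw] at hOm hPsi
    filter_upwards [hX, ae_of_ae_map hm hOm, ae_of_ae_map hm hPsi] with ω h1 h2 h3
    obtain ⟨T, hT⟩ := h2
    exact h1.isBestRankApprox_self hT hVA h3

/-- The reconstruction has a mean square error of at most a multiple of `‖A‖²`. -/
lemma lintegral_norm_sq_recon_sub_le [IsProbabilityMeasure μ] {m n k l r : ℕ} (hkl : 2 * k + 1 ≤ l)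
    {A : Matrix (Fin m) (Fin n) ℝ}
    {Om : Ω → Matrix (Fin n) (Fin k) ℝ} {Psi : Ω → Matrix (Fin l) (Fin m) ℝ}
    (hm : AEMeasurable (fun ω => (Om ω, Psi ω)) μ)
    (hlaw : μ.map (fun ω => (Om ω, Psi ω)) = testLaw m n k l)
    {Xhat : Ω → Matrix (Fin m) (Fin n) ℝ}
    (hX : ∀ᵐ ω ∂μ, IsReconstruction r (Psi ω) (A * Om ω) (Psi ω * A) (Xhat ω)) :
    ∫⁻ ω, ENNReal.ofReal (‖Xhat ω - A‖ ^ 2) ∂μ ≤ ENNReal.ofReal (18 * ‖A‖ ^ 2) := by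
  obtain ⟨h1, h2⟩ := ae_isBestRankApprox (by omega) hm hlaw hX
  rcases le_total k A.rank with hk | hk
  · have hms : Measurable fun q : Matrix (Fin n) (Fin k) ℝ × Matrix (Fin l) (Fin m) ℝ =>
        ENNReal.ofReal (‖obliqueProj (A * q.1) q.2 * A - A‖ ^ 2) :=
      ((measurable_matrix_norm ((show Continuous fun Z : Matrix (Fin m) (Fin n) ℝ => Z - A by
        fun_prop).measurable.comp (measurable_obliqueProj_mul A))).pow_const 2).ennreal_ofReal
    calc ∫⁻ ω, ENNReal.ofReal (‖Xhat ω - A‖ ^ 2) ∂μ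
        ≤ ∫⁻ ω, (ENNReal.ofReal (2 * ‖A‖ ^ 2) + ENNReal.ofReal 8 *
            ENNReal.ofReal (‖obliqueProj (A * Om ω) (Psi ω) * A - A‖ ^ 2)) ∂μ := by
          refine lintegral_mono_ae ?_
          filter_upwards [h1 hk] with ω hω
          rw [← ENNReal.ofReal_mul (by positivity),
            ← ENNReal.ofReal_add (by positivity) (by positivity)]
          refine ENNReal.ofReal_le_ofReal ?_
          set M := obliqueProj (A * Om ω) (Psi ω) * A
          have e1 : ‖M - Xhat ω‖ ≤ ‖M‖ := by simpa using hω.2 0 (by simp)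
          have e2 : ‖M‖ ≤ ‖M - A‖ + ‖A‖ := by simpa using norm_add_le (M - A) A
          have e3 : ‖Xhat ω - A‖ ≤ ‖M - A‖ + ‖M - Xhat ω‖ := by
            simpa using norm_sub_le (M - A) (M - Xhat ω)
          have e4 : ‖Xhat ω - A‖ ≤ ‖A‖ + 2 * ‖M - A‖ := by linarith
          have e5 := pow_le_pow_left₀ (norm_nonneg _) e4 2
          nlinarith [sq_nonneg (‖A‖ - 2 * ‖M - A‖)]
      _ = ENNReal.ofReal (2 * ‖A‖ ^ 2) + ENNReal.ofReal 8 *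
            ∫⁻ q, ENNReal.ofReal (‖obliqueProj (A * q.1) q.2 * A - A‖ ^ 2) ∂testLaw m n k l := by
          rw [lintegral_add_left measurable_const, lintegral_const, measure_univ, mul_one,
            lintegral_const_mul' _ _ ENNReal.ofReal_ne_top, ← hlaw,
            lintegral_map' hms.aemeasurable hm]
      _ ≤ ENNReal.ofReal (2 * ‖A‖ ^ 2) + ENNReal.ofReal 8 * (2 * ENNReal.ofReal (‖A‖ ^ 2)) := by
          gcongr
          exact (lintegral_norm_sq_obliqueProj_sub_le hkl hk).trans
            (by gcongr; exact lintegral_norm_sq_residual_le_norm hk)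
      _ = ENNReal.ofReal (18 * ‖A‖ ^ 2) := by
          rw [show (2 : ENNReal) = ENNReal.ofReal 2 by simp, ← ENNReal.ofReal_mul (by positivity),
            ← ENNReal.ofReal_mul (by positivity),
            ← ENNReal.ofReal_add (by positivity) (by positivity)]
          congr 1; ring
  · refine (lintegral_mono_ae (g := fun _ => ENNReal.ofReal (18 * ‖A‖ ^ 2)) ?_).trans_eq
      (by rw [lintegral_const, measure_univ, mul_one])
    filter_upwards [h2 hk] with ω hω
    refine ENNReal.ofReal_le_ofReal ?_
    have e1 : ‖A - Xhat ω‖ ≤ ‖A‖ := by simpa using hω.2 0 (by simp)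
    rw [norm_sub_rev]
    have := pow_le_pow_left₀ (norm_nonneg _) e1 2
    nlinarith [sq_nonneg ‖A‖]

lemma integrable_of_lintegral_sq_lt_top [IsProbabilityMeasure μ] {f : Ω → ℝ}
    (hf : AEMeasurable f μ) (h : ∫⁻ ω, ENNReal.ofReal (f ω ^ 2) ∂μ < ⊤) : Integrable f μ := by
  refine ((memLp_two_iff_integrable_sq hf.aestronglyMeasurable).2 ⟨?_, ?_⟩).integrable one_le_two
  · exact (hf.pow_const 2).aestronglyMeasurable
  · rwa [hasFiniteIntegral_iff_ofReal (ae_of_all _ fun _ => sq_nonneg _)]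

/-- Vitali's theorem for nonnegative functions that are bounded in mean square. -/
lemma tendsto_integral_of_lintegral_sq_le [IsProbabilityMeasure μ] {f : ℕ → Ω → ℝ} {g : Ω → ℝ}
    (hf : ∀ t, AEMeasurable (f t) μ) (hf0 : ∀ t ω, 0 ≤ f t ω) {K : ℝ}
    (hK : ∀ t, ∫⁻ ω, ENNReal.ofReal (f t ω ^ 2) ∂μ ≤ ENNReal.ofReal K) (hg : Integrable g μ)
    (hlim : ∀ᵐ ω ∂μ, Tendsto (fun t => f t ω) atTop (𝓝 (g ω))) :
    Tendsto (fun t => ∫ ω, f t ω ∂μ) atTop (𝓝 (∫ ω, g ω ∂μ)) := by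
  have tail : ∀ C : ℝ, 0 < C → ∀ t, eLpNorm ({ω | C ≤ f t ω}.indicator (f t)) 1 μ ≤
      ENNReal.ofReal (1 / C) * ENNReal.ofReal K := by
    intro C hC t
    rw [eLpNorm_one_eq_lintegral_enorm]
    calc ∫⁻ ω, ‖{ω | C ≤ f t ω}.indicator (f t) ω‖ₑ ∂μ
        ≤ ∫⁻ ω, ENNReal.ofReal (1 / C) * ENNReal.ofReal (f t ω ^ 2) ∂μ := by
          refine lintegral_mono fun ω => ?_
          by_cases hω : C ≤ f t ω
          · rw [Set.indicator_of_mem (show ω ∈ {ω | C ≤ f t ω} from hω),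
              Real.enorm_of_nonneg (hf0 t ω), ← ENNReal.ofReal_mul (by positivity)]
            refine ENNReal.ofReal_le_ofReal ?_
            rw [div_mul_eq_mul_div, one_mul, le_div_iff₀ hC, sq]
            exact mul_le_mul_of_nonneg_left hω (hf0 t ω)
          · rw [Set.indicator_of_notMem (show ω ∉ {ω | C ≤ f t ω} from hω)]
            simp
      _ ≤ _ := by
          rw [lintegral_const_mul' _ _ ENNReal.ofReal_ne_top]
          gcongr
          exact hK t
  have hui : UnifIntegrable f 1 μ := by
    refine unifIntegrable_of le_rfl ENNReal.one_ne_top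
      (fun t => (hf t).aestronglyMeasurable) fun ε hε => ?_
    -- `f ≤ f² / C` where `f ≥ C`, so this threshold `C` makes the tails smaller than `K / C ≤ ε`.
    have hC : 0 < (|K| + 1) / ε := by positivity
    refine ⟨Real.toNNReal ((|K| + 1) / ε), fun t => ?_⟩
    have hset : {ω | Real.toNNReal ((|K| + 1) / ε) ≤ ‖f t ω‖₊} =
        {ω | (|K| + 1) / ε ≤ f t ω} := by
      ext ω
      rw [Set.mem_ofPred_eq, Set.mem_ofPred_eq, Real.toNNReal_le_iff_le_coe, coe_nnnorm,
        Real.norm_eq_abs, abs_of_nonneg (hf0 t ω)]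
    rw [hset]
    refine (tail _ hC t).trans ?_
    rw [← ENNReal.ofReal_mul (by positivity)]
    refine ENNReal.ofReal_le_ofReal ?_
    rw [one_div_div, div_mul_eq_mul_div, div_le_iff₀ (by positivity)]
    nlinarith [le_abs_self K]
  have hfi : ∀ t, Integrable (f t) μ := fun t =>
    integrable_of_lintegral_sq_lt_top (hf t) ((hK t).trans_lt ENNReal.ofReal_lt_top)
  have h := tendsto_Lp_finite_of_tendsto_ae le_rfl ENNReal.one_ne_top
    (fun t => (hf t).aestronglyMeasurable) (memLp_one_iff_integrable.2 hg) hui hlim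
  exact tendsto_integral_of_L1' g hg.aestronglyMeasurable (Eventually.of_forall hfi) h

lemma tendsto_integral_of_lintegral_abs_sub_le [IsProbabilityMeasure μ] {f : ℕ → Ω → ℝ} {τ : ℝ}
    (hf : ∀ t, Integrable (f t) μ) {d : ℕ → ℝ} (hd0 : ∀ t, 0 ≤ d t) (hd : Tendsto d atTop (𝓝 0))
    (h : ∀ t, ∫⁻ ω, ENNReal.ofReal |f t ω - τ| ∂μ ≤ ENNReal.ofReal (d t)) :
    Tendsto (fun t => ∫ ω, f t ω ∂μ) atTop (𝓝 τ) := by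
  rw [tendsto_iff_dist_tendsto_zero]
  refine squeeze_zero (fun _ => dist_nonneg) (fun t => ?_) hd
  have h1 : ∫ ω, f t ω ∂μ - τ = ∫ ω, (f t ω - τ) ∂μ := by
    rw [integral_sub (hf t) (integrable_const τ)]; simp
  rw [Real.dist_eq, h1]
  refine (abs_integral_le_integral_abs).trans ?_
  have h2 : AEStronglyMeasurable (fun ω => |f t ω - τ|) μ :=
    ((hf t).sub (integrable_const τ)).abs.aestronglyMeasurable
  rw [integral_eq_lintegral_of_nonneg_ae (ae_of_all _ fun _ => abs_nonneg _) h2]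
  exact ENNReal.toReal_le_of_le_ofReal (hd0 t) (h t)

/-- If the limit `X'` has rank at most `k`, the residuals of the orthogonal projections of `X_t`
onto the column spaces of `X_t Ω` tend to zero in mean square. This holds although the rank of
`X_t Ω` may drop in the limit: since `X' Ω T = X'` for some `T`, the residuals are at most
`‖X_t - X_t Ω T‖`, which tends to zero. Times `t` with `rank X_t < k`, for which `colProj` is not a
projection, are left out. -/
lemma tendsto_lintegral_norm_sq_residual {m n k : ℕ} {X : ℕ → Matrix (Fin m) (Fin n) ℝ}
    {X' : Matrix (Fin m) (Fin n) ℝ} (hX : Tendsto X atTop (𝓝 X')) (hk : X'.rank ≤ k) :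
    Tendsto (fun t => if k ≤ (X t).rank then
      ∫⁻ Om, ENNReal.ofReal (‖(1 - colProj (X t * Om)) * X t‖ ^ 2) ∂gaussMat (Fin n) (Fin k)
      else 0) atTop (𝓝 0) := by
  let g : ℕ → Matrix (Fin n) (Fin k) ℝ → ENNReal := fun t Om =>
    if k ≤ (X t).rank then ENNReal.ofReal (‖(1 - colProj (X t * Om)) * X t‖ ^ 2) else 0
  have hg : ∀ t, (if k ≤ (X t).rank then
      ∫⁻ Om, ENNReal.ofReal (‖(1 - colProj (X t * Om)) * X t‖ ^ 2) ∂gaussMat (Fin n) (Fin k)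
      else 0) = ∫⁻ Om, g t Om ∂gaussMat (Fin n) (Fin k) := by
    intro t
    by_cases h : k ≤ (X t).rank <;> simp [g, h]
  simp_rw [hg]
  obtain ⟨B, hB⟩ := (hX.norm.isBoundedUnder_le).bddAbove_range
  have hdet : ∀ t, ∀ᵐ Om ∂gaussMat (Fin n) (Fin k), k ≤ (X t).rank →
      ((X t * Om)ᵀ * (X t * Om)).det ≠ 0 := fun t => by
    by_cases h : k ≤ (X t).rank
    · filter_upwards [ae_det_gram_mul_right h] with Om hOm _ using hOm
    · exact ae_of_all _ fun _ h' => absurd h' h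
  rw [show (0 : ENNReal) = ∫⁻ _, 0 ∂gaussMat (Fin n) (Fin k) by simp]
  refine tendsto_lintegral_of_dominated_convergence (fun _ => ENNReal.ofReal (B ^ 2)) ?_ ?_ ?_ ?_
  · intro t
    by_cases h : k ≤ (X t).rank
    · simp only [g, h, if_true]
      exact ((measurable_matrix_norm (measurable_residual
        (measurable_matrix_mul measurable_const measurable_id) (X t))).pow_const 2).ennreal_ofReal
    · simp only [g, h, if_false]
      exact measurable_const
  · intro t
    filter_upwards [hdet t] with Om hOm
    by_cases h : k ≤ (X t).rank
    · simp only [g, h, if_true]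
      refine ENNReal.ofReal_le_ofReal (pow_le_pow_left₀ (norm_nonneg _) ?_ 2)
      exact (norm_one_sub_colProj_mul_le_norm (hOm h) _).trans (hB ⟨t, rfl⟩)
    · simp [g, h]
  · simp
  · filter_upwards [ae_all_iff.2 hdet, ae_exists_mul_mul_eq hk] with Om h1 h2
    obtain ⟨T, hT⟩ := h2
    have hc : Continuous fun Z : Matrix (Fin m) (Fin n) ℝ =>
        ENNReal.ofReal (‖Z - Z * Om * T‖ ^ 2) :=
      ENNReal.continuous_ofReal.comp (by fun_prop)
    have hlim := (hc.tendsto X').comp hX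
    rw [hT, sub_self, norm_zero, zero_pow two_ne_zero, ENNReal.ofReal_zero] at hlim
    refine tendsto_of_tendsto_of_tendsto_of_le_of_le tendsto_const_nhds hlim
      (fun _ => zero_le) fun t => ?_
    by_cases h : k ≤ (X t).rank
    · simp only [g, h, if_true, Function.comp_apply]
      refine ENNReal.ofReal_le_ofReal (pow_le_pow_left₀ (norm_nonneg _) ?_ 2)
      exact norm_one_sub_colProj_mul_le (h1 t h) (X t) T
    · simp [g, h]

end Convergence

/-! ### The limit of the expected error -/

section Limit

attribute [local instance] matrixMeasurableSpace matrix_borelSpace matrix_secondCountableTopology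

variable {Ω : Type*} [MeasurableSpace Ω] {μ : Measure Ω}

lemma continuousAt_obliqueProj_mul {m n k l : ℕ} {X : Matrix (Fin m) (Fin n) ℝ}
    {Om : Matrix (Fin n) (Fin k) ℝ} {Psi : Matrix (Fin l) (Fin m) ℝ}
    (h : ((Psi * (X * Om))ᵀ * (Psi * (X * Om))).det ≠ 0) :
    ContinuousAt (fun Z : Matrix (Fin m) (Fin n) ℝ => obliqueProj (Z * Om) Psi * Z) X := by
  have hG : Continuous fun Z : Matrix (Fin m) (Fin n) ℝ =>
      (Psi * (Z * Om))ᵀ * (Psi * (Z * Om)) := by fun_prop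
  have hinv : ContinuousAt (fun Z : Matrix (Fin m) (Fin n) ℝ =>
      ((Psi * (Z * Om))ᵀ * (Psi * (Z * Om)))⁻¹) X := by
    simp_rw [Matrix.inv_def, Ring.inverse_eq_inv']
    exact (hG.matrix_det.continuousAt.inv₀ h).smul hG.matrix_adjugate.continuousAt
  have hmul : ∀ {a b c : ℕ} {F : Matrix (Fin m) (Fin n) ℝ → Matrix (Fin a) (Fin b) ℝ}
      {G : Matrix (Fin m) (Fin n) ℝ → Matrix (Fin b) (Fin c) ℝ}, ContinuousAt F X →
      ContinuousAt G X → ContinuousAt (fun Z => F Z * G Z) X := fun hF hG =>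
    (continuous_fst.matrix_mul continuous_snd).continuousAt.comp (hF.prodMk hG)
  unfold obliqueProj leftInv
  refine hmul (hmul (hmul ?_ (hmul hinv ?_)) continuousAt_const) continuousAt_id
  · exact Continuous.continuousAt (by fun_prop)
  · exact Continuous.continuousAt (by fun_prop)

lemma aemeasurable_norm_sub {m n : ℕ} {G : Ω → Matrix (Fin m) (Fin n) ℝ}
    (h : ∀ i j, AEMeasurable (fun ω => G ω i j) μ) (X : Matrix (Fin m) (Fin n) ℝ) :
    AEMeasurable (fun ω => ‖G ω - X‖) μ :=
  (show Continuous fun Z : Matrix (Fin m) (Fin n) ℝ => ‖Z - X‖ by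
    fun_prop).measurable.comp_aemeasurable (aemeasurable_matrix h)

variable [IsProbabilityMeasure μ] {m n k l r : ℕ}
  {X : ℕ → Matrix (Fin m) (Fin n) ℝ} {X' : Matrix (Fin m) (Fin n) ℝ}
  {Om : Ω → Matrix (Fin n) (Fin k) ℝ} {Psi : Ω → Matrix (Fin l) (Fin m) ℝ}
  {Xhat : ℕ → Ω → Matrix (Fin m) (Fin n) ℝ}

/-- The mean square distance of the reconstructions from the limit is bounded uniformly in time. -/
lemma exists_lintegral_norm_sq_le (hkl : 2 * k + 1 ≤ l) (hX : Tendsto X atTop (𝓝 X'))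
    (hm : AEMeasurable (fun ω => (Om ω, Psi ω)) μ)
    (hlaw : μ.map (fun ω => (Om ω, Psi ω)) = testLaw m n k l)
    (hrec : ∀ t, ∀ᵐ ω ∂μ, IsReconstruction r (Psi ω) (X t * Om ω) (Psi ω * X t) (Xhat t ω)) :
    ∃ K : ℝ, ∀ t, ∫⁻ ω, ENNReal.ofReal (‖Xhat t ω - X'‖ ^ 2) ∂μ ≤ ENNReal.ofReal K := by
  obtain ⟨B, hB⟩ := (hX.norm.isBoundedUnder_le).bddAbove_range
  obtain ⟨C, hC⟩ := ((hX.sub_const X').norm.isBoundedUnder_le).bddAbove_range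
  refine ⟨2 * C ^ 2 + 2 * (18 * B ^ 2), fun t => ?_⟩
  have hBt : ‖X t‖ ≤ B := hB ⟨t, rfl⟩
  have hCt : ‖X t - X'‖ ≤ C := hC ⟨t, rfl⟩
  calc ∫⁻ ω, ENNReal.ofReal (‖Xhat t ω - X'‖ ^ 2) ∂μ
      ≤ ∫⁻ ω, (ENNReal.ofReal (2 * C ^ 2) +
          ENNReal.ofReal 2 * ENNReal.ofReal (‖Xhat t ω - X t‖ ^ 2)) ∂μ := by
        refine lintegral_mono fun ω => ?_
        rw [← ENNReal.ofReal_mul (by positivity),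
          ← ENNReal.ofReal_add (by positivity) (by positivity)]
        refine ENNReal.ofReal_le_ofReal ?_
        have e1 : ‖Xhat t ω - X'‖ ≤ ‖Xhat t ω - X t‖ + C :=
          (norm_sub_le_norm_sub_add_norm_sub _ (X t) _).trans (by linarith)
        have e2 := pow_le_pow_left₀ (norm_nonneg _) e1 2
        nlinarith [sq_nonneg (‖Xhat t ω - X t‖ - C)]
    _ = ENNReal.ofReal (2 * C ^ 2) +
          ENNReal.ofReal 2 * ∫⁻ ω, ENNReal.ofReal (‖Xhat t ω - X t‖ ^ 2) ∂μ := by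
        rw [lintegral_add_left measurable_const, lintegral_const, measure_univ, mul_one,
          lintegral_const_mul' _ _ ENNReal.ofReal_ne_top]
    _ ≤ ENNReal.ofReal (2 * C ^ 2) + ENNReal.ofReal 2 * ENNReal.ofReal (18 * B ^ 2) := by
        gcongr
        exact (lintegral_norm_sq_recon_sub_le hkl hm hlaw (hrec t)).trans
          (ENNReal.ofReal_le_ofReal (by gcongr))
    _ = _ := by
        rw [← ENNReal.ofReal_mul (by positivity),
          ← ENNReal.ofReal_add (by positivity) (by positivity)]

/-- If the sketch is large enough to determine the limit, then the expected distances tend to that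
of the limit from the matrices of rank at most `r`. -/
lemma tendsto_integral_of_rank_le (hkl : 2 * k + 1 ≤ l) (hX : Tendsto X atTop (𝓝 X'))
    (hm : AEMeasurable (fun ω => (Om ω, Psi ω)) μ)
    (hlaw : μ.map (fun ω => (Om ω, Psi ω)) = testLaw m n k l)
    (hrec : ∀ t, ∀ᵐ ω ∂μ, IsReconstruction r (Psi ω) (X t * Om ω) (Psi ω * X t) (Xhat t ω))
    (hint : ∀ t, Integrable (fun ω => ‖Xhat t ω - X'‖) μ) (hk : X'.rank ≤ k)
    {Xr : Matrix (Fin m) (Fin n) ℝ} (hXr : IsBestRankApprox r X' Xr) :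
    Tendsto (fun t => ∫ ω, ‖Xhat t ω - X'‖ ∂μ) atTop (𝓝 ‖X' - Xr‖) := by
  have he := tendsto_lintegral_norm_sq_residual hX hk
  set e : ℕ → ENNReal := fun t => if k ≤ (X t).rank then
      ∫⁻ Om, ENNReal.ofReal (‖(1 - colProj (X t * Om)) * X t‖ ^ 2) ∂gaussMat (Fin n) (Fin k)
      else 0 with hedef
  have htop : ∀ t, e t ≠ ⊤ := fun t => by
    by_cases h : k ≤ (X t).rank
    · simp only [hedef, h, if_true]
      exact ((lintegral_norm_sq_residual_le_norm h).trans_lt ENNReal.ofReal_lt_top).ne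
    · simp [hedef, h]
  let c : ℕ → ℝ := fun t => √(2 * (e t).toReal)
  have hc0 : ∀ t, 0 ≤ c t := fun t => Real.sqrt_nonneg _
  have hc : Tendsto c atTop (𝓝 0) := by
    have h := (ENNReal.tendsto_toReal ENNReal.zero_ne_top).comp he
    have h' := (Real.continuous_sqrt.tendsto _).comp (h.const_mul 2)
    simpa [Function.comp_def, c] using h'
  refine tendsto_integral_of_lintegral_abs_sub_le (d := fun t => 2 * (c t + ‖X t - X'‖)) hint
    (fun t => by have := hc0 t; positivity) ?_ fun t => ?_
  · have h := (hc.add (hX.sub_const X').norm).const_mul 2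
    simpa using h
  obtain ⟨h1, h2⟩ := ae_isBestRankApprox (r := r) (by omega) hm hlaw (hrec t)
  rcases le_total k (X t).rank with hkt | hkt
  · have hms : Measurable fun q : Matrix (Fin n) (Fin k) ℝ × Matrix (Fin l) (Fin m) ℝ =>
        ‖obliqueProj (X t * q.1) q.2 * X t - X t‖ :=
      measurable_matrix_norm ((show Continuous fun Z : Matrix (Fin m) (Fin n) ℝ => Z - X t by
        fun_prop).measurable.comp (measurable_obliqueProj_mul (X t)))
    have hsq : ∫⁻ q, ENNReal.ofReal (‖obliqueProj (X t * q.1) q.2 * X t - X t‖ ^ 2)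
        ∂testLaw m n k l ≤ ENNReal.ofReal (c t ^ 2) := by
      refine (lintegral_norm_sq_obliqueProj_sub_le hkl hkt).trans_eq ?_
      rw [Real.sq_sqrt (by positivity), ENNReal.ofReal_mul (by positivity),
        ENNReal.ofReal_toReal (htop t)]
      simp [hedef, hkt]
    have hle := lintegral_ofReal_le_of_sq (hc0 t) hsq
    rw [← hlaw, lintegral_map' hms.ennreal_ofReal.aemeasurable hm] at hle
    calc ∫⁻ ω, ENNReal.ofReal |‖Xhat t ω - X'‖ - ‖X' - Xr‖| ∂μ
        ≤ ∫⁻ ω, (ENNReal.ofReal 2 * ENNReal.ofReal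
            ‖obliqueProj (X t * Om ω) (Psi ω) * X t - X t‖ +
            ENNReal.ofReal (2 * ‖X t - X'‖)) ∂μ := by
          refine lintegral_mono_ae ?_
          filter_upwards [h1 hkt] with ω hω
          rw [← ENNReal.ofReal_mul (by positivity),
            ← ENNReal.ofReal_add (by positivity) (by positivity)]
          refine ENNReal.ofReal_le_ofReal ((hω.abs_norm_sub_le hXr).trans ?_)
          have := norm_sub_le_norm_sub_add_norm_sub
            (obliqueProj (X t * Om ω) (Psi ω) * X t) (X t) X'
          linarith
      _ = ENNReal.ofReal 2 * ∫⁻ ω, ENNReal.ofReal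
            ‖obliqueProj (X t * Om ω) (Psi ω) * X t - X t‖ ∂μ +
            ENNReal.ofReal (2 * ‖X t - X'‖) := by
          rw [lintegral_add_right _ measurable_const, lintegral_const, measure_univ, mul_one,
            lintegral_const_mul' _ _ ENNReal.ofReal_ne_top]
      _ ≤ ENNReal.ofReal 2 * ENNReal.ofReal (c t) + ENNReal.ofReal (2 * ‖X t - X'‖) := by
          gcongr
      _ = ENNReal.ofReal (2 * (c t + ‖X t - X'‖)) := by
          have := hc0 t
          rw [← ENNReal.ofReal_mul (by positivity),
            ← ENNReal.ofReal_add (by positivity) (by positivity), mul_add]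
  · refine (lintegral_mono_ae (g := fun _ => ENNReal.ofReal (2 * (c t + ‖X t - X'‖))) ?_).trans_eq
      (by rw [lintegral_const, measure_univ, mul_one])
    filter_upwards [h2 hkt] with ω hω
    refine ENNReal.ofReal_le_ofReal ((hω.abs_norm_sub_le hXr).trans ?_)
    linarith [hc0 t]

/-- If the limit `X'` has rank at least `k`, then the errors of the reconstructions almost surely
tend to the error of a reconstruction from the sketch of `X'`, and so do their expectations. -/
lemma exists_tendsto_integral_of_le_rank (hrk : 2 * r + 1 ≤ k) (hkl : 2 * k + 1 ≤ l)
    (hX : Tendsto X atTop (𝓝 X'))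
    (hm : AEMeasurable (fun ω => (Om ω, Psi ω)) μ)
    (hlaw : μ.map (fun ω => (Om ω, Psi ω)) = testLaw m n k l)
    (hrec : ∀ t, ∀ᵐ ω ∂μ, IsReconstruction r (Psi ω) (X t * Om ω) (Psi ω * X t) (Xhat t ω))
    (hmeas : ∀ t i j, AEMeasurable (fun ω => Xhat t ω i j) μ) (hk : k ≤ X'.rank)
    {Xr : Matrix (Fin m) (Fin n) ℝ} (hXr : IsBestRankApprox r X' Xr) :
    ∃ L ≤ 3 * √2 * ‖X' - Xr‖, Tendsto (fun t => ∫ ω, ‖Xhat t ω - X'‖ ∂μ) atTop (𝓝 L) := by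
  choose D hD using fun q : Matrix (Fin n) (Fin k) ℝ × Matrix (Fin l) (Fin m) ℝ =>
    exists_isBestRankApprox r (obliqueProj (X' * q.1) q.2 * X')
  let g : Ω → ℝ := fun ω => ‖D (Om ω, Psi ω) - X'‖
  have hdet := ae_testLaw_det_gram (l := l) (by omega) hk
  have hamb := ae_testLaw_notMem_ambiguousSet (l := l) r (by omega) hk
  obtain ⟨b, hbm, hb, hbint⟩ := exists_error_bound hrk hkl hk hXr
  rw [← hlaw] at hdet hamb hb hbint
  -- The Gram determinant is not zero for `X'`, hence for `X_t` with large `t`, which makes the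
  -- oblique projections converge. Their best approximations need not, but their distances to `X'`
  -- do, since the limit is not in the ambiguous set.
  have hlim : ∀ᵐ ω ∂μ, Tendsto (fun t => ‖Xhat t ω - X'‖) atTop (𝓝 (g ω)) := by
    filter_upwards [ae_all_iff.2 hrec, ae_of_ae_map hm hdet, ae_of_ae_map hm hamb]
      with ω h1 h2 h3
    have hev : ∀ᶠ t in atTop,
        ((Psi ω * (X t * Om ω))ᵀ * (Psi ω * (X t * Om ω))).det ≠ 0 := by
      have hc : Continuous fun Z : Matrix (Fin m) (Fin n) ℝ =>
          ((Psi ω * (Z * Om ω))ᵀ * (Psi ω * (Z * Om ω))).det := by fun_prop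
      exact ((hc.tendsto X').comp hX).eventually_ne h2
    obtain ⟨N, hN⟩ := eventually_atTop.1 hev
    have hXN : Tendsto (fun t => X (t + N)) atTop (𝓝 X') := (tendsto_add_atTop_iff_nat N).2 hX
    have hM : Tendsto (fun t => obliqueProj (X (t + N) * Om ω) (Psi ω) * X (t + N)) atTop
        (𝓝 (obliqueProj (X' * Om ω) (Psi ω) * X')) :=
      Tendsto.comp (g := fun Z => obliqueProj (Z * Om ω) (Psi ω) * Z)
        (f := fun t => X (t + N)) (continuousAt_obliqueProj_mul h2) hXN
    have hbest : ∀ t, IsBestRankApprox r (obliqueProj (X (t + N) * Om ω) (Psi ω) * X (t + N))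
        (Xhat (t + N) ω) := fun t => by
      have h4 := (h1 (t + N)).isBestRankApprox (hN (t + N) (by omega))
      rw [obliqueProj, Matrix.mul_assoc _ (Psi ω)]
      exact h4
    have huniq : ∀ D', IsBestRankApprox r (obliqueProj (X' * Om ω) (Psi ω) * X') D' →
        ‖D' - X'‖ = ‖D (Om ω, Psi ω) - X'‖ := fun D' hD' =>
      not_not.1 fun h => h3 ⟨D', D (Om ω, Psi ω), hD', hD (Om ω, Psi ω), h⟩
    exact (tendsto_add_atTop_iff_nat N).1 (tendsto_norm_sub_of_isBestRankApprox hM hbest huniq)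
  have hf : ∀ t, AEMeasurable (fun ω => ‖Xhat t ω - X'‖) μ := fun t =>
    aemeasurable_norm_sub (hmeas t) X'
  have hgm : AEMeasurable g μ := aemeasurable_of_tendsto_metrizable_ae atTop hf hlim
  have hg0 : 0 ≤ᵐ[μ] g := ae_of_all _ fun _ => norm_nonneg _
  have hle : ∫⁻ ω, ENNReal.ofReal (g ω) ∂μ ≤ ENNReal.ofReal (3 * √2 * ‖X' - Xr‖) := by
    rw [lintegral_map' hbm.ennreal_ofReal.aemeasurable hm] at hbint
    refine (lintegral_mono_ae ?_).trans hbint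
    filter_upwards [ae_of_ae_map hm hb] with ω hω
    exact ENNReal.ofReal_le_ofReal (hω _ (hD (Om ω, Psi ω)))
  have hgi : Integrable g μ := by
    refine ⟨hgm.aestronglyMeasurable, ?_⟩
    rw [hasFiniteIntegral_iff_ofReal hg0]
    exact hle.trans_lt ENNReal.ofReal_lt_top
  obtain ⟨K, hK⟩ := exists_lintegral_norm_sq_le hkl hX hm hlaw hrec
  refine ⟨∫ ω, g ω ∂μ, ?_, tendsto_integral_of_lintegral_sq_le hf
    (fun _ _ => norm_nonneg _) hK hgi hlim⟩
  rw [integral_eq_lintegral_of_nonneg_ae hg0 hgm.aestronglyMeasurable]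
  exact ENNReal.toReal_le_of_le_ofReal (by positivity) hle

end Limit

end SketchyCGM

theorem theorem2 {m n d : ℕ} (r : ℕ)
    -- the data of the model problem
    (A : Fin d → Matrix (Fin m) (Fin n) ℝ)
    (f : EuclideanSpace ℝ (Fin d) → ℝ) (hf_convex : ConvexOn ℝ Set.univ f)
    (hf_smooth : ContDiff ℝ 1 f) (α : ℝ) (hα : 0 ≤ α)
    -- the singular vector routine
    (maxSingVec : ℕ → Matrix (Fin m) (Fin n) ℝ → (Fin m → ℝ) × (Fin n → ℝ))
    (h_msv : ∀ t M, SketchyCGM.IsMaxSingPair M (maxSingVec t M).1 (maxSingVec t M).2)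
    -- the CGM iterates converge
    (Xcgm : Matrix (Fin m) (Fin n) ℝ)
    (h_conv : Tendsto (SketchyCGM.cgm A f α maxSingVec) atTop (𝓝 Xcgm))
    -- the random test matrices
    {Ω : Type*} [MeasurableSpace Ω] (μ : Measure Ω) [IsProbabilityMeasure μ]
    (Omega : Ω → Matrix (Fin n) (Fin (2 * r + 1)) ℝ)
    (Psi : Ω → Matrix (Fin (4 * r + 3)) (Fin m) ℝ)
    (h_Omega : SketchyCGM.IsStandardNormal Omega μ)
    (h_Psi : SketchyCGM.IsStandardNormal Psi μ)
    (h_indep : SketchyCGM.IndepMatrices Omega Psi μ)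
    -- the rank-r reconstructions from the sketches of SketchyCGM
    (Xhat : ℕ → Ω → Matrix (Fin m) (Fin n) ℝ)
    (h_meas : ∀ t i j, AEMeasurable (fun ω => Xhat t ω i j) μ)
    (h_recon : ∀ t, ∀ᵐ ω ∂μ, SketchyCGM.IsReconstruction r (Psi ω)
      (SketchyCGM.sketchyCGM A f α maxSingVec (Omega ω) (Psi ω) t).Y
      (SketchyCGM.sketchyCGM A f α maxSingVec (Omega ω) (Psi ω) t).W (Xhat t ω)) :
    (∀ t, Integrable (fun ω => ‖Xhat t ω - Xcgm‖) μ) ∧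
    (∃ L : ℝ, Tendsto (fun t => ∫ ω, ‖Xhat t ω - Xcgm‖ ∂μ) atTop (𝓝 L) ∧
      ∀ Xr : Matrix (Fin m) (Fin n) ℝ, SketchyCGM.IsBestRankApprox r Xcgm Xr →
        L ≤ 3 * √2 * ‖Xcgm - Xr‖) ∧
    (Xcgm.rank ≤ r → Tendsto (fun t => ∫ ω, ‖Xhat t ω - Xcgm‖ ∂μ) atTop (𝓝 0)) := by
  simp only [SketchyCGM.sketchyCGM_eq] at h_recon
  obtain ⟨hm, hlaw⟩ := SketchyCGM.map_prodMk_eq_testLaw h_Omega h_Psi h_indep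
  have hkl : 2 * (2 * r + 1) + 1 ≤ 4 * r + 3 := by omega
  obtain ⟨K, hK⟩ := SketchyCGM.exists_lintegral_norm_sq_le hkl h_conv hm hlaw h_recon
  have hint : ∀ t, Integrable (fun ω => ‖Xhat t ω - Xcgm‖) μ := fun t =>
    SketchyCGM.integrable_of_lintegral_sq_lt_top (SketchyCGM.aemeasurable_norm_sub (h_meas t) _)
      ((hK t).trans_lt ENNReal.ofReal_lt_top)
  refine ⟨hint, ?_, fun hr => ?_⟩
  -- If the sketch determines the limit, the limit of the errors is exactly `‖Xcgm - [Xcgm]_r‖`.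
  · obtain ⟨X₀, hX₀⟩ := SketchyCGM.exists_isBestRankApprox r Xcgm
    have hX₀' : ∀ Xr, SketchyCGM.IsBestRankApprox r Xcgm Xr → ‖Xcgm - X₀‖ = ‖Xcgm - Xr‖ :=
      fun Xr hXr => hX₀.norm_sub_eq_infDist.trans hXr.norm_sub_eq_infDist.symm
    rcases le_total Xcgm.rank (2 * r + 1) with hk | hk
    · refine ⟨‖Xcgm - X₀‖, SketchyCGM.tendsto_integral_of_rank_le hkl h_conv hm hlaw h_recon
        hint hk hX₀, fun Xr hXr => ?_⟩
      rw [hX₀' Xr hXr]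
      have h2 : (1 : ℝ) ≤ √2 := Real.one_le_sqrt.2 one_le_two
      nlinarith [norm_nonneg (Xcgm - Xr)]
    · obtain ⟨L, hL, hlim⟩ := SketchyCGM.exists_tendsto_integral_of_le_rank le_rfl hkl h_conv hm
        hlaw h_recon h_meas hk hX₀
      exact ⟨L, hlim, fun Xr hXr => by rw [← hX₀' Xr hXr]; exact hL⟩
  · have h := SketchyCGM.tendsto_integral_of_rank_le hkl h_conv hm hlaw h_recon hint
      (by omega) (Xr := Xcgm) ⟨hr, fun D _ => by simp⟩
    rwa [sub_self, norm_zero] at h
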